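/- A \emph{pattern} on $k$ vertices is a totally ordered set of $k$ vertices in which every unordered pair of distinct vertices is declared mandatory, forbidden or undecided. An \emph{ordered graph} $(G,\tau)$ is a finite simple graph $G$ with a total ordering $\tau$ of its vertices; it \emph{contains} a pattern $P$ if it has $k$ vertices $v_1<_\tau\dots<_\tau v_k$ such that $v_iv_j$ is an edge of $G$ whenever the pair of the $i$-th and $j$-th vertices of $P$ is mandatory, and a non-edge whenever that pair is forbidden; otherwise it avoids $P$. A set $S$ of patterns \emph{characterizes} the class of all finite graphs that admit a vertex ordering avoiding every pattern of $S$. \emph{Detecting} $S$ is the problem of deciding, given an ordered graph by adjacency lists and its ordering, whether it contains at least one pattern of $S$; it can be done \emph{in linear time} if it is solved by a random access machine in $O(n+m)$ steps on ordered graphs with $n$ vertices and $m$ edges. \textbf{Theorem.} Let $\mathcal C$ be a graph class characterized by a set of forbidden patterns on three vertices that is none of the following four classes: comparability graphs, complements of comparability graphs, triangle-free graphs, complements of triangle-free graphs. Then there is a set $S'$ of patterns on three vertices that characterizes $\mathcal C$ and that can be detected in linear time. -/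

import Mathlib

/-! ### Patterns and ordered graphs -/

/-- A pattern on `k` vertices. The totally ordered vertex set is `Fin k`; every pair of distinct
vertices is either mandatory, or forbidden, or (when it is in neither graph) undecided. -/
structure Pattern (k : ℕ) where
  mandatory : SimpleGraph (Fin k)
  forbidden : SimpleGraph (Fin k)
  disjoint : Disjoint mandatory forbidden

/-- The undecided pairs of a pattern. -/
def Pattern.undecided {k : ℕ} (P : Pattern k) : SimpleGraph (Fin k) :=
  (P.mandatory ⊔ P.forbidden)ᶜ

/-- `H` realizes `P`: its edges are the mandatory edges and some of the undecided pairs. -/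
def Pattern.IsRealization {k : ℕ} (P : Pattern k) (H : SimpleGraph (Fin k)) : Prop :=
  P.mandatory ≤ H ∧ H ≤ P.mandatory ⊔ P.undecided

/-- A total ordering of a set `V` of `n` vertices is an enumeration `τ : Fin n ≃ V`, where `τ i`
is the vertex at position `i`. The ordered graph `(G, τ)` contains `P` if some `k` positions,
taken in increasing order, induce a realization of `P`. -/
def Contains {V : Type} {n k : ℕ} (G : SimpleGraph V) (τ : Fin n ≃ V) (P : Pattern k) : Prop :=
  ∃ f : Fin k ↪o Fin n, P.IsRealization (G.comap fun i => τ (f i))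

/-- `(G, τ)` contains at least one of the patterns of `S`. -/
def ContainsSome {V : Type} {n k : ℕ} (G : SimpleGraph V) (τ : Fin n ≃ V)
    (S : Set (Pattern k)) : Prop :=
  ∃ P ∈ S, Contains G τ P

/-! ### Graph classes -/

/-- A class of finite simple graphs. -/
abbrev GraphClass : Type 1 := ∀ (V : Type) [Finite V], SimpleGraph V → Prop

/-- `C` is the class of the finite graphs that have a vertex ordering avoiding every pattern
of `S`. -/
def Characterizes {k : ℕ} (S : Set (Pattern k)) (C : GraphClass) : Prop :=
  ∀ (V : Type) [Finite V] (G : SimpleGraph V),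
    C V G ↔ ∃ (n : ℕ) (τ : Fin n ≃ V), ¬ ContainsSome G τ S

/-- Comparability graphs: adjacency is comparability of distinct elements in a partial order. -/
def comparabilityGraphs : GraphClass := fun V _ G =>
  ∃ p : PartialOrder V, ∀ u v : V, G.Adj u v ↔ p.lt u v ∨ p.lt v u

/-- Triangle-free graphs. -/
def triangleFreeGraphs : GraphClass := fun _ _ G => G.CliqueFree 3

/-- The complement class: the graphs whose complement lies in `C`. -/
def GraphClass.co (C : GraphClass) : GraphClass := fun V _ G => C V Gᶜ

/-! ### A random access machine with step count

Programs are structured programs with finitely many registers and arrays of natural numbers,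
all of them initially zero apart from the input. The arithmetic is successor, truncated
subtraction and comparison, so a run of `t` steps raises the largest value present (including
the constants of the program) by at most `t`: in a linear-time run all the numbers have
`O(log N)` bits for inputs of size `N`, and charging one step per operation is legitimate. -/

/-- Expressions: constants, registers, entries of arrays, and arithmetic. -/
inductive Expr : Type
  | const (k : ℕ)
  | var (x : ℕ)
  | read (a : ℕ) (i : Expr)
  | succ (e : Expr)
  | sub (e e' : Expr)
  | lt (e e' : Expr)
  | eq (e e' : Expr)

/-- Contents of the registers and of the arrays. -/
structure State : Type where
  var : ℕ → ℕ
  arr : ℕ → ℕ → ℕ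

/-- The value of an expression; comparisons have value `1` (true) or `0` (false). -/
def Expr.eval (s : State) : Expr → ℕ
  | .const k => k
  | .var x => s.var x
  | .read a i => s.arr a (i.eval s)
  | .succ e => e.eval s + 1
  | .sub e e' => e.eval s - e'.eval s
  | .lt e e' => if e.eval s < e'.eval s then 1 else 0
  | .eq e e' => if e.eval s = e'.eval s then 1 else 0

/-- The number of steps needed to evaluate an expression: one for each of its nodes. -/
def Expr.cost : Expr → ℕ
  | .const _ => 1
  | .var _ => 1
  | .read _ i => i.cost + 1
  | .succ e => e.cost + 1
  | .sub e e' => e.cost + e'.cost + 1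
  | .lt e e' => e.cost + e'.cost + 1
  | .eq e e' => e.cost + e'.cost + 1

/-- Programs. -/
inductive Cmd : Type
  | skip
  | assign (x : ℕ) (e : Expr)
  | write (a : ℕ) (i e : Expr)
  | seq (c d : Cmd)
  | ite (e : Expr) (c d : Cmd)
  | loop (e : Expr) (c : Cmd)

/-- Store `v` in register `x`. -/
def State.setVar (s : State) (x v : ℕ) : State :=
  { s with var := Function.update s.var x v }

/-- Store `v` in entry `i` of array `a`. -/
def State.setArr (s : State) (a i v : ℕ) : State :=
  { s with arr := Function.update s.arr a (Function.update (s.arr a) i v) }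

/-- `Exec c s t s'`: the program `c`, started in state `s`, halts after `t` steps in
state `s'`. The command `loop e c` repeats `c` as long as `e` is nonzero. -/
inductive Exec : Cmd → State → ℕ → State → Prop
  | skip (s : State) : Exec .skip s 1 s
  | assign (x : ℕ) (e : Expr) (s : State) :
      Exec (.assign x e) s (e.cost + 1) (s.setVar x (e.eval s))
  | write (a : ℕ) (i e : Expr) (s : State) :
      Exec (.write a i e) s (i.cost + e.cost + 1) (s.setArr a (i.eval s) (e.eval s))
  | seq {c d : Cmd} {s s' s'' : State} {t t' : ℕ} (hc : Exec c s t s') (hd : Exec d s' t' s'') :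
      Exec (.seq c d) s (t + t') s''
  | iteTrue {e : Expr} {c d : Cmd} {s s' : State} {t : ℕ} (he : e.eval s ≠ 0)
      (hc : Exec c s t s') : Exec (.ite e c d) s (e.cost + t + 1) s'
  | iteFalse {e : Expr} {c d : Cmd} {s s' : State} {t : ℕ} (he : e.eval s = 0)
      (hd : Exec d s t s') : Exec (.ite e c d) s (e.cost + t + 1) s'
  | loopDone {e : Expr} {c : Cmd} {s : State} (he : e.eval s = 0) :
      Exec (.loop e c) s (e.cost + 1) s
  | loopStep {e : Expr} {c : Cmd} {s s' s'' : State} {t t' : ℕ} (he : e.eval s ≠ 0)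
      (hc : Exec c s t s') (hl : Exec (.loop e c) s' t' s'') :
      Exec (.loop e c) s (e.cost + t + 1 + t') s''

/-! ### The detection problem -/

/-- An adjacency-list description of a graph with vertices `0, …, n - 1`: for each vertex a list
of its neighbours, each neighbour once, in any order. -/
structure AdjLists {n : ℕ} (G : SimpleGraph (Fin n)) where
  list : Fin n → List (Fin n)
  nodup : ∀ v, (list v).Nodup
  mem_iff : ∀ v w, w ∈ list v ↔ G.Adj v w

/-- The input of the detection problem. Register `0` holds the number `n` of vertices; array `0`
holds the vertices in the order `τ`; array `2` holds the adjacency lists of the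
vertices `0, …, n - 1` one after the other; the list of vertex `v` fills the entries of array `2`
from the number in entry `v` of array `1` up to, and excluding, the number in entry `v + 1`. -/
def inputState {n : ℕ} {G : SimpleGraph (Fin n)} (L : AdjLists G) (τ : Fin n ≃ Fin n) : State where
  var := Function.update (fun _ => 0) 0 n
  arr := fun a i =>
    if a = 0 then ((List.ofFn τ).map Fin.val).getD i 0
    else if a = 1 then
      if i ≤ n then (((List.ofFn L.list).take i).map List.length).sum else 0
    else if a = 2 then ((List.ofFn L.list).flatten.map Fin.val).getD i 0
    else 0

/-- Detection of the set `S` of patterns in linear time: one program decides, for every ordered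
graph `(G, τ)` given by adjacency lists, whether `(G, τ)` contains at least one pattern of `S`
(answer `1` or `0` in register `1`), in `O(n + m)` steps for `n` vertices and `m` edges. -/
def LinearTimeDetectable {k : ℕ} (S : Set (Pattern k)) : Prop :=
  ∃ (c : Cmd) (K : ℕ), ∀ (n : ℕ) (G : SimpleGraph (Fin n)) (L : AdjLists G) (τ : Fin n ≃ Fin n),
    ∃ (t : ℕ) (s : State), Exec c (inputState L τ) t s ∧
      t ≤ K * (n + G.edgeSet.ncard + 1) ∧
      (ContainsSome G τ S → s.var 1 = 1) ∧
      (¬ ContainsSome G τ S → s.var 1 = 0)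

/-! The type of an ordered triple `i < j < k` records whether `ij`, `jk`, `ik` are edges; below it
is written as three bits in this order. A set of patterns matters only through the set `F` of types
that realize it (`containsSome_iff`), and every set of types comes from patterns
(`exists_typesOf_eq`). So one may replace `F` by any set of types with the same class, and must find
one that is detectable in linear time.

A type whose first two bits differ is detectable alone. Up to reversal and complement it is 101, and
if 101 occurs, then it occurs with the first later neighbour of its first position in the middle;
counting common neighbours reveals this (`hasTriple_true_false_true_iff`). A type with equal first
two bits is tested together with a second type. If the second type has different first two bits,
either the two differ in one bit and degrees suffice, or the first may be sought assuming that the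
second is absent (`detects_ne_or_eq`). If both have equal first two bits but their third bits
differ, there are four pairs: two are settled by degrees, 110 with 001 by the scores of a tournament
(`hasTriple_cyclic_iff`), and 111 with 000 by Ramsey's theorem. Hence `detects_types` covers every
`F` except those whose types all have equal first two bits and a common third bit.

The exceptions are the empty set, the four singletons, which give exactly the excluded classes, and
the pairs {111, 001} and {000, 110}. An ordering that avoids 111 and 001 forces the graph to be
bipartite (`exists_two_coloring`), and the ordering can then be rearranged to avoid 110 as well
(`avoiders_bipartite_permutation`). Adding 110 therefore keeps the class and makes the set
detectable; the other pair is the complement of this one.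

For the time bounds, functions of the positions are tabulated in arrays. Tabulation is closed under
pointwise operations, composition and folds over neighbourhoods (`LinComp.scatter`), and all the
tests are assembled from these. -/

/-! ### Running programs within a time bound -/

/-- The program `c`, started in `s`, halts within `T` steps in a state that satisfies `Q`. -/
def Runs (c : Cmd) (s : State) (T : ℕ) (Q : State → Prop) : Prop :=
  ∃ t s', Exec c s t s' ∧ t ≤ T ∧ Q s'

theorem Runs.mono {c : Cmd} {s : State} {T T' : ℕ} {Q Q' : State → Prop} (h : Runs c s T Q)
    (hT : T ≤ T') (hQ : ∀ s', Q s' → Q' s') : Runs c s T' Q' := by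
  obtain ⟨t, s', he, ht, hq⟩ := h
  exact ⟨t, s', he, ht.trans hT, hQ _ hq⟩

theorem Runs.seq {c d : Cmd} {s : State} {T T' : ℕ} {Q Q' : State → Prop} (h : Runs c s T Q)
    (h' : ∀ s', Q s' → Runs d s' T' Q') : Runs (.seq c d) s (T + T') Q' := by
  obtain ⟨t, s', he, ht, hq⟩ := h
  obtain ⟨t', s'', he', ht', hq'⟩ := h' _ hq
  exact ⟨t + t', s'', he.seq he', by omega, hq'⟩

/-- Commands without loops. -/
def Cmd.LoopFree : Cmd → Prop
  | .skip => True
  | .assign _ _ => True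
  | .write _ _ _ => True
  | .seq c d => c.LoopFree ∧ d.LoopFree
  | .ite _ c d => c.LoopFree ∧ d.LoopFree
  | .loop _ _ => False

/-- The final state of a loop-free command. -/
def Cmd.run : Cmd → State → State
  | .skip, s => s
  | .assign x e, s => s.setVar x (e.eval s)
  | .write a i e, s => s.setArr a (i.eval s) (e.eval s)
  | .seq c d, s => d.run (c.run s)
  | .ite e c d, s => if e.eval s = 0 then d.run s else c.run s
  | .loop _ _, s => s

/-- A bound on the number of steps of a loop-free command. -/
def Cmd.bound : Cmd → ℕ
  | .skip => 1
  | .assign _ e => e.cost + 1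
  | .write _ i e => i.cost + e.cost + 1
  | .seq c d => c.bound + d.bound
  | .ite e c d => e.cost + (c.bound + d.bound) + 1
  | .loop _ _ => 0

theorem Cmd.LoopFree.exec {c : Cmd} (hc : c.LoopFree) (s : State) :
    ∃ t, Exec c s t (c.run s) ∧ t ≤ c.bound := by
  induction c generalizing s with
  | skip => exact ⟨_, .skip s, le_rfl⟩
  | assign x e => exact ⟨_, .assign x e s, le_rfl⟩
  | write a i e => exact ⟨_, .write a i e s, le_rfl⟩
  | seq c d hc' hd' =>
    obtain ⟨t, h, ht⟩ := hc' hc.1 s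
    obtain ⟨t', h', ht'⟩ := hd' hc.2 (c.run s)
    exact ⟨_, h.seq h', Nat.add_le_add ht ht'⟩
  | ite e c d hc' hd' =>
    by_cases he : e.eval s = 0
    · obtain ⟨t', h', ht'⟩ := hd' hc.2 s
      refine ⟨_, .iteFalse he (by simpa [Cmd.run, he] using h'), ?_⟩
      simp only [Cmd.bound]; omega
    · obtain ⟨t', h', ht'⟩ := hc' hc.1 s
      refine ⟨_, .iteTrue he (by simpa [Cmd.run, he] using h'), ?_⟩
      simp only [Cmd.bound]; omega
  | loop e c _ => exact hc.elim

/-- Reduces a loop-free body to evaluating `Cmd.run`, at a cost independent of the state. -/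
theorem Cmd.LoopFree.runs {c : Cmd} (hc : c.LoopFree) {s : State} {Q : State → Prop}
    (hQ : Q (c.run s)) : Runs c s c.bound Q := by
  obtain ⟨t, h, ht⟩ := hc.exec s
  exact ⟨t, _, h, ht, hQ⟩

/-- A loop whose `k`-th iteration leads from `I k` to `I (k + 1)`. -/
theorem runs_loop {e : Expr} {c : Cmd} {I : ℕ → State → Prop} {T : ℕ → ℕ} {n : ℕ}
    (hstep : ∀ k < n, ∀ s, I k s → e.eval s ≠ 0 ∧ Runs c s (T k) (I (k + 1)))
    (hexit : ∀ s, I n s → e.eval s = 0) {s : State} (hs : I 0 s) :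
    Runs (.loop e c) s (∑ k ∈ Finset.range n, (T k + e.cost + 1) + (e.cost + 1)) (I n) := by
  have key : ∀ m k, k + m = n → ∀ s, I k s →
      Runs (.loop e c) s (∑ j ∈ Finset.range m, (T (k + j) + e.cost + 1) + (e.cost + 1)) (I n) := by
    intro m
    induction m with
    | zero =>
      intro k hk s hs
      obtain rfl : k = n := by omega
      exact ⟨_, s, .loopDone (hexit s hs), by simp, hs⟩
    | succ m ih =>
      intro k hk s hs
      obtain ⟨he, t, s', hx, ht, hI⟩ := hstep k (by omega) s hs
      obtain ⟨t', s'', hx', ht', hI'⟩ := ih (k + 1) (by omega) s' hI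
      refine ⟨_, s'', .loopStep he hx hx', ?_, hI'⟩
      rw [Finset.sum_range_succ']
      have : ∑ j ∈ Finset.range m, (T (k + (j + 1)) + e.cost + 1) =
          ∑ j ∈ Finset.range m, (T (k + 1 + j) + e.cost + 1) :=
        Finset.sum_congr rfl fun j _ => by rw [show k + (j + 1) = k + 1 + j by omega]
      rw [this, add_zero]
      omega
  simpa using key n 0 (by omega) s hs

@[simp] theorem State.setVar_var (s : State) (x v y : ℕ) :
    (s.setVar x v).var y = if y = x then v else s.var y := by
  simp [State.setVar, Function.update_apply]

@[simp] theorem State.setVar_arr (s : State) (x v : ℕ) : (s.setVar x v).arr = s.arr := rfl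

@[simp] theorem State.setArr_var (s : State) (a i v : ℕ) : (s.setArr a i v).var = s.var := rfl

@[simp] theorem State.setArr_arr (s : State) (a i v b j : ℕ) :
    (s.setArr a i v).arr b j = if b = a ∧ j = i then v else s.arr b j := by
  by_cases hb : b = a
  · subst hb
    simp [State.setArr, Function.update_apply]
  · simp [State.setArr, hb]

theorem State.setArr_arr_ne (s : State) {a b : ℕ} (i v : ℕ) (h : b ≠ a) :
    (s.setArr a i v).arr b = s.arr b := by
  simp [State.setArr, h]

/-- Repeat `c` with register `x` running through the numbers below register `0`. -/
def forRange (x : ℕ) (c : Cmd) : Cmd :=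
  .seq (.assign x (.const 0))
    (.loop (.lt (.var x) (.var 0)) (.seq c (.assign x (.succ (.var x)))))

/-- The invariant `I` sees the arrays only, so every register except `0` and `x` is scratch space.
Anything that must survive an iteration is stored in an array. -/
theorem runs_forRange {x : ℕ} (hx : x ≠ 0) {c : Cmd} {n : ℕ} {T : ℕ → ℕ}
    {I : ℕ → (ℕ → ℕ → ℕ) → Prop} {s : State} (hn : s.var 0 = n) (hI : I 0 s.arr)
    (hstep : ∀ i < n, ∀ s, s.var 0 = n → s.var x = i → I i s.arr →
      Runs c s (T i) (fun s' => s'.var 0 = n ∧ s'.var x = i ∧ I (i + 1) s'.arr)) :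
    Runs (forRange x c) s (∑ k ∈ Finset.range n, T k + 7 * n + 6)
      (fun s' => s'.var 0 = n ∧ I n s'.arr) := by
  have h1 : Runs (.assign x (.const 0)) s 2
      (fun s => s.var 0 = n ∧ s.var x = 0 ∧ I 0 s.arr) := by
    refine ⟨_, _, .assign x _ s, by simp [Expr.cost], ?_⟩
    simp [Expr.eval, hx.symm, hn, hI]
  have h2 := fun s' hs' => runs_loop (e := .lt (.var x) (.var 0))
    (c := .seq c (.assign x (.succ (.var x)))) (n := n) (T := fun i => T i + 3)
    (I := fun k s => s.var 0 = n ∧ s.var x = k ∧ I k s.arr) (s := s')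
    (by
      rintro k hk s ⟨h0, h1, h2⟩
      refine ⟨by simp [Expr.eval, h0, h1, hk], (hstep k hk s h0 h1 h2).seq (T' := 3) ?_⟩
      rintro s' ⟨h0, h1, h2⟩
      refine ⟨_, _, .assign x _ s', by simp [Expr.cost], ?_⟩
      simp [Expr.eval, hx.symm, h0, h1, h2])
    (by
      rintro s ⟨h0, h1, h2⟩
      simp [Expr.eval, h0, h1]) hs'
  refine (h1.seq h2).mono ?_ (fun s' h => ⟨h.1, h.2.2⟩)
  simp only [Expr.cost, Finset.sum_add_distrib, Finset.sum_const, Finset.card_range, smul_eq_mul]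
  omega

/-! ### Ordered graphs as lists of neighbouring positions -/

/-- A graph on the positions `0, …, n - 1`, given by lists of neighbours. -/
structure OrdAdj where
  n : ℕ
  nbrs : ℕ → List ℕ
  nodup : ∀ i, (nbrs i).Nodup
  lt_of_mem : ∀ {i j}, j ∈ nbrs i → j < n
  symm : ∀ {i j}, j ∈ nbrs i → i ∈ nbrs j
  irrefl : ∀ i, i ∉ nbrs i

namespace OrdAdj

/-- Adjacency of positions. -/
def Adj (D : OrdAdj) (i j : ℕ) : Prop := j ∈ D.nbrs i

/-- The size of the representation. -/
def size (D : OrdAdj) : ℕ := D.n + ∑ i ∈ Finset.range D.n, (D.nbrs i).length + 1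

end OrdAdj

/-- The arrays `1` to `4` of the state hold the graph `D`: array `4` is the ordering of the
vertices, array `3` the position of each vertex, arrays `1` and `2` are adjacency lists. -/
structure Ready (D : OrdAdj) (s : State) : Prop where
  var_zero : s.var 0 = D.n
  list_end : ∀ i < D.n, s.arr 1 (s.arr 4 i + 1) = s.arr 1 (s.arr 4 i) + (D.nbrs i).length
  entry : ∀ i < D.n, ∀ r, ∀ h : r < (D.nbrs i).length,
    s.arr 3 (s.arr 2 (s.arr 1 (s.arr 4 i) + r)) = (D.nbrs i)[r]

/-- Register `0` and the arrays below `a` are unchanged. -/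
def Frame (a : ℕ) (s s' : State) : Prop := s'.var 0 = s.var 0 ∧ ∀ b < a, s'.arr b = s.arr b

theorem Frame.trans {a b : ℕ} {s s' s'' : State} (h : Frame a s s') (h' : Frame b s' s'')
    (hab : a ≤ b) : Frame a s s'' :=
  ⟨h'.1.trans h.1, fun c hc => (h'.2 c (by omega)).trans (h.2 c hc)⟩

theorem Ready.frame {D : OrdAdj} {s s' : State} (h : Ready D s) {a : ℕ} (ha : 5 ≤ a)
    (hf : Frame a s s') : Ready D s' := by
  have h1 := hf.2 1 (by omega)
  have h2 := hf.2 2 (by omega)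
  have h3 := hf.2 3 (by omega)
  have h4 := hf.2 4 (by omega)
  refine ⟨hf.1.trans h.var_zero, ?_, ?_⟩
  · rw [h1, h4]; exact h.list_end
  · rw [h1, h2, h3, h4]; exact h.entry

/-! ### Functions of the positions that can be tabulated in linear time -/

/-- The function `f` of the positions can be tabulated in linear time, in any array from `5` on,
without changing the arrays below it. -/
def LinComp (f : OrdAdj → ℕ → ℕ) : Prop :=
  ∀ a, 5 ≤ a → ∃ c K, ∀ D s, Ready D s →
    Runs c s (K * D.size) (fun s' => Frame a s s' ∧ ∀ i < D.n, s'.arr a i = f D i)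

theorem LinComp.congr {f g : OrdAdj → ℕ → ℕ} (hf : LinComp f)
    (h : ∀ D, ∀ i < D.n, f D i = g D i) : LinComp g := by
  intro a ha
  obtain ⟨c, K, H⟩ := hf a ha
  exact ⟨c, K, fun D s hs => (H D s hs).mono le_rfl
    fun s' hs' => ⟨hs'.1, fun i hi => (hs'.2 i hi).trans (h D i hi)⟩⟩

theorem OrdAdj.n_le_size (D : OrdAdj) : D.n ≤ D.size := by
  unfold OrdAdj.size; omega

theorem OrdAdj.one_le_size (D : OrdAdj) : 1 ≤ D.size := by
  unfold OrdAdj.size; omega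

/-- Loop over all positions, with a loop-free body that writes array `b` at the current position. -/
theorem runs_tabulate {b : ℕ} {c : Cmd} (hc : c.LoopFree) {n : ℕ} {f : ℕ → ℕ}
    {s₀ : State} (hn : s₀.var 0 = n)
    (hstep : ∀ i < n, ∀ s, s.var 0 = n → s.var 2 = i → (∀ d, d ≠ b → s.arr d = s₀.arr d) →
      (c.run s).var 0 = n ∧ (c.run s).var 2 = i ∧ (∀ d, d ≠ b → (c.run s).arr d = s₀.arr d) ∧
      (c.run s).arr b i = f i ∧ ∀ j, j ≠ i → (c.run s).arr b j = s.arr b j) :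
    Runs (forRange 2 c) s₀ ((c.bound + 7) * n + 6)
      (fun s' => s'.var 0 = n ∧ (∀ d, d ≠ b → s'.arr d = s₀.arr d) ∧ ∀ i < n, s'.arr b i = f i) := by
  refine (runs_forRange (T := fun _ => c.bound) (by norm_num) hn
    (I := fun k A => (∀ d, d ≠ b → A d = s₀.arr d) ∧ ∀ i < k, A b i = f i)
    ⟨fun _ _ => rfl, by simp⟩ ?_).mono ?_ (fun _ h => h)
  · rintro i hi s h0 h2 ⟨h3, h4⟩
    obtain ⟨g0, g2, g3, g4, g5⟩ := hstep i hi s h0 h2 h3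
    refine hc.runs ⟨g0, g2, g3, fun j hj => ?_⟩
    rcases Nat.lt_succ_iff_lt_or_eq.mp hj with hj | rfl
    · rw [g5 j (by omega), h4 j hj]
    · exact g4
  · simp only [Finset.sum_const, Finset.card_range, smul_eq_mul]
    nlinarith

/-- Tabulation of a binary operation of two tabulated functions. The expression `E` finds the
position in register `2` and the two values in registers `3` and `4`. -/
theorem LinComp.map₂ {f g : OrdAdj → ℕ → ℕ} (hf : LinComp f) (hg : LinComp g) (E : Expr)
    (op : ℕ → ℕ → ℕ → ℕ → ℕ)
    (hE : ∀ s : State, E.eval s = op (s.var 0) (s.var 2) (s.var 3) (s.var 4)) :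
    LinComp (fun D i => op D.n i (f D i) (g D i)) := by
  intro a ha
  -- Arrays from `a` on are free. Computing `g` in array `a + 2` leaves the table of `f` in array `a
  -- + 1` intact, and the result goes to array `a`.
  obtain ⟨c, K, hc⟩ := hf (a + 1) (by omega)
  obtain ⟨d, K', hd⟩ := hg (a + 2) (by omega)
  let b : Cmd := .seq (.assign 3 (.read (a + 1) (.var 2)))
    (.seq (.assign 4 (.read (a + 2) (.var 2))) (.write a (.var 2) E))
  refine ⟨.seq c (.seq d (forRange 2 b)), K + (K' + (b.bound + 13)), fun D s hs => ?_⟩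
  refine ((hc D s hs).seq fun s₁ h₁ => ((hd D s₁ (hs.frame (by omega) h₁.1)).seq fun s₂ h₂ =>
    (runs_tabulate (b := a) (c := b) (n := D.n) (f := fun i => op D.n i (f D i) (g D i))
      ⟨trivial, trivial, trivial⟩ ?_ ?_).mono le_rfl ?_).mono le_rfl (fun _ h => h)).mono ?_
      (fun _ h => h)
  · rw [h₂.1.1, h₁.1.1, hs.var_zero]
  · intro i hi s h0 h2 h3
    refine ⟨by simpa [b, Cmd.run] using h0, by simpa [b, Cmd.run] using h2, fun d hd => ?_, ?_, ?_⟩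
    · simp only [b, Cmd.run]
      rw [State.setArr_arr_ne _ _ _ hd]
      exact h3 d hd
    · have e1 : s.arr (a + 1) i = f D i := by
        rw [h3 _ (by omega), h₂.1.2 _ (by omega), h₁.2 i hi]
      have e2 : s.arr (a + 2) i = g D i := by
        rw [h3 _ (by omega), h₂.2 i hi]
      simp [b, Cmd.run, hE, Expr.eval, h0, h2, e1, e2]
    · intro j hj
      simp [b, Cmd.run, Expr.eval, h2, hj]
  · rintro s' ⟨h0, h1, h2⟩
    refine ⟨⟨by rw [h0, hs.var_zero], fun d hd => ?_⟩, h2⟩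
    rw [h1 d (by omega), h₂.1.2 d (by omega), h₁.1.2 d (by omega)]
  · have := D.n_le_size
    have := D.one_le_size
    nlinarith

/-- Values that depend only on the number of vertices and the position. -/
theorem LinComp.expr (E : Expr) (op : ℕ → ℕ → ℕ)
    (hE : ∀ s : State, E.eval s = op (s.var 0) (s.var 2)) :
    LinComp (fun D i => op D.n i) := by
  intro a ha
  let b : Cmd := .write a (.var 2) E
  refine ⟨forRange 2 b, b.bound + 13, fun D s hs => ?_⟩
  refine (runs_tabulate (b := a) (c := b) (n := D.n) (f := fun i => op D.n i)
      trivial hs.var_zero ?_).mono ?_ ?_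
  · intro i hi s h0 h2 h3
    refine ⟨by simpa [b, Cmd.run] using h0, by simpa [b, Cmd.run] using h2, fun d hd => ?_, ?_, ?_⟩
    · simp only [b, Cmd.run]
      rw [State.setArr_arr_ne _ _ _ hd]
      exact h3 d hd
    · simp [b, Cmd.run, hE, Expr.eval, h0, h2]
    · intro j hj
      simp [b, Cmd.run, Expr.eval, h2, hj]
  · have := D.n_le_size
    have := D.one_le_size
    nlinarith
  · rintro s' ⟨h0, h1, h2⟩
    exact ⟨⟨by rw [h0, hs.var_zero], fun d hd => h1 d (by omega)⟩, h2⟩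

theorem LinComp.map {f : OrdAdj → ℕ → ℕ} (hf : LinComp f) (E : Expr) (op : ℕ → ℕ → ℕ → ℕ)
    (hE : ∀ s : State, E.eval s = op (s.var 0) (s.var 2) (s.var 3)) :
    LinComp (fun D i => op D.n i (f D i)) :=
  LinComp.map₂ hf hf E (fun n i x _ => op n i x) hE

/-- Composition of tabulated functions. -/
theorem LinComp.comp {f g : OrdAdj → ℕ → ℕ} (hf : LinComp f) (hg : LinComp g) :
    LinComp (fun D i => if g D i < D.n then f D (g D i) else 0) := by
  intro a ha
  obtain ⟨c, K, hc⟩ := hf (a + 1) (by omega)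
  obtain ⟨d, K', hd⟩ := hg (a + 2) (by omega)
  let b : Cmd := .seq (.assign 3 (.read (a + 2) (.var 2)))
    (.ite (.lt (.var 3) (.var 0)) (.write a (.var 2) (.read (a + 1) (.var 3)))
      (.write a (.var 2) (.const 0)))
  refine ⟨.seq c (.seq d (forRange 2 b)), K + (K' + (b.bound + 13)), fun D s hs => ?_⟩
  refine ((hc D s hs).seq fun s₁ h₁ => ((hd D s₁ (hs.frame (by omega) h₁.1)).seq fun s₂ h₂ =>
    (runs_tabulate (b := a) (c := b) (n := D.n)
      (f := fun i => if g D i < D.n then f D (g D i) else 0)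
      ⟨trivial, trivial, trivial⟩ ?_ ?_).mono le_rfl ?_).mono le_rfl (fun _ h => h)).mono ?_
      (fun _ h => h)
  · rw [h₂.1.1, h₁.1.1, hs.var_zero]
  · intro i hi s h0 h2 h3
    have e2 : s.arr (a + 2) i = g D i := by
      rw [h3 _ (by omega), h₂.2 i hi]
    have e1 : g D i < D.n → s.arr (a + 1) (g D i) = f D (g D i) := fun h => by
      rw [h3 _ (by omega), h₂.1.2 _ (by omega), h₁.2 _ h]
    have hrun : b.run s = (s.setVar 3 (g D i)).setArr a i
        (if g D i < D.n then f D (g D i) else 0) := by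
      by_cases hg : g D i < D.n
      · simp [b, Cmd.run, Expr.eval, h0, h2, e2, hg, e1 hg]
      · simp [b, Cmd.run, Expr.eval, h0, h2, e2, hg]
    rw [hrun]
    refine ⟨by simpa using h0, by simpa using h2, fun d hd => ?_, by simp, fun j hj => by simp [hj]⟩
    rw [State.setArr_arr_ne _ _ _ hd]
    exact h3 d hd
  · rintro s' ⟨h0, h1, h2⟩
    refine ⟨⟨by rw [h0, hs.var_zero], fun d hd => ?_⟩, h2⟩
    rw [h1 d (by omega), h₂.1.2 d (by omega), h₁.1.2 d (by omega)]
  · have := D.n_le_size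
    have := D.one_le_size
    nlinarith

/-- The last position with a given value of a tabulated function. -/
def lastWith (f : ℕ → ℕ) : ℕ → ℕ → ℕ
  | 0, _ => 0
  | k + 1, x => if f k = x then k else lastWith f k x

/-- Array `a + 2` is indexed by the values of `f`; each position writes itself into the entry of its
value, so the last one remains. The array need not be cleared, because only entries of values that
do occur are read. -/
theorem LinComp.last {f : OrdAdj → ℕ → ℕ} (hf : LinComp f) :
    LinComp (fun D i => lastWith (f D) D.n (f D i)) := by
  intro a ha
  obtain ⟨c, K, hc⟩ := hf (a + 1) (by omega)
  let b₁ : Cmd := .write (a + 2) (.read (a + 1) (.var 2)) (.var 2)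
  let b : Cmd := .write a (.var 2) (.read (a + 2) (.read (a + 1) (.var 2)))
  refine ⟨.seq c (.seq (forRange 2 b₁) (forRange 2 b)), K + (b₁.bound + b.bound + 26),
    fun D s hs => ?_⟩
  refine ((hc D s hs).seq fun s₁ h₁ => ((runs_forRange (T := fun _ => b₁.bound) (by norm_num)
    (n := D.n) (I := fun k A => (∀ d, d ≠ a + 2 → A d = s₁.arr d) ∧
      ∀ i < D.n, (∃ j < k, f D j = f D i) → A (a + 2) (f D i) = lastWith (f D) k (f D i))
      ?_ ?_ ?_).seq
      (Q' := fun s' => Frame a s s' ∧ ∀ i < D.n, s'.arr a i = lastWith (f D) D.n (f D i))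
      fun s₂ h₂ => (runs_tabulate (b := a) (c := b) (n := D.n)
        (f := fun i => lastWith (f D) D.n (f D i)) trivial h₂.1 ?_).mono le_rfl ?_)).mono ?_
      (fun _ h => h)
  · rw [h₁.1.1, hs.var_zero]
  · exact ⟨fun _ _ => rfl, by simp⟩
  · rintro i hi s h0 h2 ⟨h3, h4⟩
    have e1 : s.arr (a + 1) i = f D i := by rw [h3 _ (by omega), h₁.2 i hi]
    refine Cmd.LoopFree.runs (show b₁.LoopFree from trivial) ⟨by simpa [b₁, Cmd.run] using h0,
      by simpa [b₁, Cmd.run] using h2, fun d hd => ?_, fun j hj hx => ?_⟩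
    · simp only [b₁, Cmd.run]
      rw [State.setArr_arr_ne _ _ _ hd]
      exact h3 d hd
    · by_cases hij : f D i = f D j
      · simp [b₁, Cmd.run, Expr.eval, h2, e1, lastWith, hij]
      · obtain ⟨k, hk, hkj⟩ := hx
        have hk' : k < i := by
          rcases Nat.lt_succ_iff_lt_or_eq.mp hk with h | rfl
          · exact h
          · exact absurd hkj hij
        simp [b₁, Cmd.run, Expr.eval, h2, e1, lastWith, hij, Ne.symm hij, h4 j hj ⟨k, hk', hkj⟩]
  · intro i hi s h0 h2 h3
    refine ⟨by simpa [b, Cmd.run] using h0, by simpa [b, Cmd.run] using h2, fun d hd => ?_, ?_, ?_⟩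
    · simp only [b, Cmd.run]
      rw [State.setArr_arr_ne _ _ _ hd]
      exact h3 d hd
    · have e1 : s.arr (a + 1) i = f D i := by
        rw [h3 _ (by omega), h₂.2.1 _ (by omega), h₁.2 i hi]
      have e2 : s.arr (a + 2) (f D i) = lastWith (f D) D.n (f D i) := by
        rw [h3 _ (by omega), h₂.2.2 i hi ⟨i, hi, rfl⟩]
      simp [b, Cmd.run, Expr.eval, h2, e1, e2]
    · intro j hj
      simp [b, Cmd.run, Expr.eval, h2, hj]
  · rintro s' ⟨h0, h1, h2⟩
    refine ⟨⟨by rw [h0, hs.var_zero], fun d hd => ?_⟩, h2⟩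
    rw [h1 d (by omega), h₂.2.1 d (by omega), h₁.1.2 d (by omega)]
  · simp only [Finset.sum_const, Finset.card_range, smul_eq_mul]
    have := D.n_le_size
    have := D.one_le_size
    nlinarith

theorem List.mem_take_succ_iff {l : List ℕ} {r : ℕ} (h : r < l.length) (j : ℕ) :
    j ∈ l.take (r + 1) ↔ j ∈ l.take r ∨ j = l[r] := by
  rw [List.take_succ_eq_append_getElem h, List.mem_append, List.mem_singleton]

theorem List.Nodup.getElem_notMem_take {l : List ℕ} (hl : l.Nodup) {r : ℕ} (h : r < l.length) :
    l[r] ∉ l.take r := by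
  intro hm
  obtain ⟨k, hk, e⟩ := List.mem_take_iff_getElem.mp hm
  have := (List.Nodup.getElem_inj_iff hl).mp e
  omega

/-- Repeat `c` with register `3` running through the neighbours of the current position; register
`9` holds the current vertex and register `8` the end of its list. -/
def forNbrs (c : Cmd) : Cmd :=
  .seq (.assign 7 (.read 1 (.var 9)))
    (.loop (.lt (.var 7) (.var 8))
      (.seq (.assign 3 (.read 3 (.read 2 (.var 7)))) (.seq c (.assign 7 (.succ (.var 7))))))

/-- The registers while position `i` is treated. -/
def AtPos (D : OrdAdj) (s₀ : State) (i : ℕ) (s : State) : Prop :=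
  s.var 0 = D.n ∧ s.var 2 = i ∧ s.var 8 = s₀.arr 1 (s₀.arr 4 i + 1) ∧ s.var 9 = s₀.arr 4 i ∧
    ∀ d < 5, s.arr d = s₀.arr d

/-- The body may use registers `1` and `3` to `6` and the arrays from `5` on; `J r` describes the
arrays after the first `r` neighbours. The cost is proportional to the degree, which makes the sum
over all positions linear. -/
theorem runs_forNbrs {D : OrdAdj} {s₀ s : State} (hr : Ready D s₀) {i : ℕ} (hi : i < D.n) {c : Cmd}
    (hc : c.LoopFree) {J : ℕ → (ℕ → ℕ → ℕ) → Prop} (hs : AtPos D s₀ i s) (hJ : J 0 s.arr)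
    (hstep : ∀ r, ∀ h : r < (D.nbrs i).length, ∀ s : State, s.var 0 = D.n → s.var 2 = i →
      s.var 3 = (D.nbrs i)[r] → J r s.arr →
      (∀ x, x = 0 ∨ x = 2 ∨ 7 ≤ x → (c.run s).var x = s.var x) ∧
      (∀ d < 5, (c.run s).arr d = s.arr d) ∧ J (r + 1) (c.run s).arr) :
    Runs (forNbrs c) s ((c.bound + 11) * (D.nbrs i).length + 7)
      (fun s' => AtPos D s₀ i s' ∧ J (D.nbrs i).length s'.arr) := by
  have h1 : Runs (.assign 7 (.read 1 (.var 9))) s 3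
      (fun s => AtPos D s₀ i s ∧ s.var 7 = s₀.arr 1 (s₀.arr 4 i) + 0 ∧ J 0 s.arr) := by
    refine ⟨_, _, .assign 7 _ s, by simp [Expr.cost], ?_⟩
    obtain ⟨g0, g1, g2, g3, g4⟩ := hs
    simpa [AtPos, Expr.eval, g0, g1, g2, g3, hJ, g4 1 (by norm_num)] using g4
  have h2 := fun s' hs' => runs_loop (e := .lt (.var 7) (.var 8))
    (c := .seq (.assign 3 (.read 3 (.read 2 (.var 7)))) (.seq c (.assign 7 (.succ (.var 7)))))
    (n := (D.nbrs i).length) (T := fun _ => c.bound + 7)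
    (I := fun r s => AtPos D s₀ i s ∧ s.var 7 = s₀.arr 1 (s₀.arr 4 i) + r ∧ J r s.arr) (s := s')
    (by
      rintro r hr' s ⟨⟨g0, g1, g2, g3, g4⟩, h7, hJ⟩
      refine ⟨by simp [Expr.eval, g2, h7, hr.list_end i hi, hr'], ?_⟩
      have hlf : (Cmd.seq (.assign 3 (.read 3 (.read 2 (.var 7))))
        (.seq c (.assign 7 (.succ (.var 7))))).LoopFree := ⟨trivial, hc, trivial⟩
      obtain ⟨k1, k2, k3⟩ := hstep r hr' (s.setVar 3 (D.nbrs i)[r]) (by simpa using g0)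
        (by simpa using g1) (by simp) (by simpa using hJ)
      refine (hlf.runs ?_).mono (by simp [Cmd.bound, Expr.cost]; omega) (fun _ h => h)
      have e : (Expr.read 3 (.read 2 (.var 7))).eval s = (D.nbrs i)[r] := by
        simp only [Expr.eval, h7, g4 3 (by norm_num), g4 2 (by norm_num)]
        exact hr.entry i hi r hr'
      simp only [Cmd.run]
      rw [e]
      simp only [AtPos, Expr.eval, State.setVar_var, State.setVar_arr]
      have k0 := k1 0 (by simp)
      have k2' := k1 2 (by simp)
      have k7 := k1 7 (by simp)
      have k8 := k1 8 (by simp)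
      have k9 := k1 9 (by simp)
      simp at k0 k2' k7 k8 k9
      refine ⟨⟨?_, ?_, ?_, ?_, ?_⟩, ?_, k3⟩
      · simpa using k0.trans g0
      · simpa using k2'.trans g1
      · simpa using k8.trans g2
      · simpa using k9.trans g3
      · intro d hd
        rw [k2 d hd]; exact g4 d hd
      · simp [k7, h7]; omega)
    (by
      rintro s ⟨⟨g0, g1, g2, g3, g4⟩, h7, hJ⟩
      simp [Expr.eval, g2, h7, hr.list_end i hi]) hs'
  refine (h1.seq h2).mono ?_ (fun s' h => ⟨h.1, h.2.2⟩)
  simp only [Expr.cost, Finset.sum_const, Finset.card_range, smul_eq_mul]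
  nlinarith

open Classical in
/-- Fold over those neighbours of `j` that are smaller than the last argument, in increasing
order. -/
noncomputable def OrdAdj.fold (D : OrdAdj) (x : ℕ) (h : ℕ → ℕ → ℕ) (j : ℕ) : ℕ → ℕ
  | 0 => x
  | k + 1 => if D.Adj k j then h k (D.fold x h j k) else D.fold x h j k

open Classical in
/-- Folds over neighbourhoods can be tabulated in linear time, even when the folded function asks
whether the current neighbour of `j` is adjacent to the position `g j`. The new value is that of
`E` if the value of `C` is not zero, and the old value otherwise. The expressions find
the neighbour in register `2`, the position `j` in register `3`, the value so far in register `4`,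
`g j` in register `5`, and the answer to this question in register `6`. -/
theorem LinComp.scatter {g : OrdAdj → ℕ → ℕ} (hg : LinComp g) (E₀ C E : Expr) (op₀ : ℕ → ℕ → ℕ)
    (op : ℕ → ℕ → ℕ → ℕ → ℕ → ℕ → ℕ) (hE₀ : ∀ s : State, E₀.eval s = op₀ (s.var 0) (s.var 2))
    (hE : ∀ s : State,
      (if C.eval s = 0 then s.var 4 else E.eval s) =
        op (s.var 0) (s.var 2) (s.var 3) (s.var 4) (s.var 5) (s.var 6)) :
    LinComp (fun D j => D.fold (op₀ D.n j) (fun i x => op D.n i j x (g D j)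
      (if D.Adj i (g D j) then 1 else 0)) j D.n) := by
  intro a ha
  obtain ⟨c, K, hc⟩ := hg (a + 1) (by omega)
  let b₁ : Cmd := .write a (.var 2) E₀
  let b₂ : Cmd := .write (a + 2) (.var 2) (.const 0)
  let hd : Cmd := .seq (.assign 9 (.read 4 (.var 2))) (.assign 8 (.read 1 (.succ (.var 9))))
  -- Marks the neighbours of the current position `i` with `i + 1`. Marks of earlier rounds are at
  -- most `i`, so they need no erasing, and `0` means unmarked.
  let b₃ : Cmd := .write (a + 2) (.var 3) (.succ (.var 2))
  -- Comparing the mark of `g j` with `i + 1` tells in constant time whether `i` and `g j` are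
  -- adjacent. Marks are trusted only below `n`, hence the guard.
  let b₄ : Cmd := .seq (.assign 4 (.read a (.var 3))) (.seq (.assign 5 (.read (a + 1) (.var 3)))
    (.seq (.ite (.lt (.var 5) (.var 0))
      (.assign 6 (.eq (.read (a + 2) (.var 5)) (.succ (.var 2)))) (.assign 6 (.const 0)))
      (.ite C (.write a (.var 3) E) (.write a (.var 3) (.var 4)))))
  have hlast : ∀ s, (Cmd.ite C (.write a (.var 3) E) (.write a (.var 3) (.var 4))).run s =
      s.setArr a (s.var 3)
        (op (s.var 0) (s.var 2) (s.var 3) (s.var 4) (s.var 5) (s.var 6)) := fun s => by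
    rw [← hE]
    simp only [Cmd.run, Expr.eval]
    split_ifs <;> rfl
  refine ⟨.seq c (.seq (forRange 2 b₁) (.seq (forRange 2 b₂)
    (forRange 2 (.seq hd (.seq (forNbrs b₃) (forNbrs b₄)))))),
    K + (b₁.bound + b₂.bound + hd.bound + b₃.bound + b₄.bound + 100), fun D s hs => ?_⟩
  set F : ℕ → ℕ → ℕ := fun j => D.fold (op₀ D.n j) (fun i x => op D.n i j x (g D j)
      (if D.Adj i (g D j) then 1 else 0)) j with hF
  refine ((hc D s hs).seq fun s₁ h₁ => (runs_tabulate (b := a) (c := b₁) (n := D.n)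
    (f := fun j => op₀ D.n j) trivial ?_ ?_).seq fun s₂ h₂ =>
    (runs_tabulate (b := a + 2) (c := b₂) (n := D.n) (f := fun _ => 0) trivial h₂.1 ?_).seq
      fun s₃ h₃ => (runs_forRange (by norm_num) (n := D.n)
    (T := fun i => hd.bound + (((b₃.bound + 11) * (D.nbrs i).length + 7) +
      ((b₄.bound + 11) * (D.nbrs i).length + 7)))
    -- After round `k` each `j` has absorbed its neighbours below `k`. The outer loop runs over the
    -- neighbour rather than over `j`, so each fold proceeds in increasing order even though the
    -- adjacency lists are unsorted.
    (I := fun k A => (∀ d, d ≠ a → d ≠ a + 2 → A d = s₁.arr d) ∧ (∀ j < D.n, A a j = F j k) ∧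
      ∀ j < D.n, A (a + 2) j ≤ k) ?_ ?_ ?_).mono le_rfl
      (Q' := fun s' => Frame a s s' ∧ ∀ j < D.n, s'.arr a j = F j D.n) ?_).mono ?_ (fun _ h => h)
  · rw [h₁.1.1, hs.var_zero]
  · intro i hi s h0 h2 h3
    refine ⟨by simpa [b₁, Cmd.run] using h0, by simpa [b₁, Cmd.run] using h2,
      fun d hd => ?_, by simp [b₁, Cmd.run, hE₀, Expr.eval, h0, h2],
      fun j hj => by simp [b₁, Cmd.run, Expr.eval, h2, hj]⟩
    simp only [b₁, Cmd.run]
    rw [State.setArr_arr_ne _ _ _ hd]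
    exact h3 d hd
  · intro i hi s h0 h2 h3
    refine ⟨by simpa [b₂, Cmd.run] using h0, by simpa [b₂, Cmd.run] using h2,
      fun d hd => ?_, by simp [b₂, Cmd.run, Expr.eval, h2],
      fun j hj => by simp [b₂, Cmd.run, Expr.eval, h2, hj]⟩
    simp only [b₂, Cmd.run]
    rw [State.setArr_arr_ne _ _ _ hd]
    exact h3 d hd
  · exact h₃.1
  · refine ⟨fun d hd hd' => (h₃.2.1 d hd').trans (h₂.2.1 d hd), fun j hj => ?_, fun j hj => ?_⟩
    · rw [h₃.2.1 a (by omega), h₂.2.2 j hj]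
      rfl
    · rw [h₃.2.2 j hj]
  · rintro i hi s h0 h2 ⟨h3, h4, h5⟩
    have hr : Ready D s₁ := hs.frame (by omega) h₁.1
    have hhd : hd.LoopFree := ⟨trivial, trivial⟩
    refine (hhd.runs (Q := fun s' => AtPos D s₁ i s' ∧ s'.arr = s.arr) ?_).seq fun s₄ h₄ => ?_
    · have hlt : ∀ d < 5, s.arr d = s₁.arr d := fun d hd => h3 d (by omega) (by omega)
      simpa [hd, Cmd.run, AtPos, Expr.eval, h0, h2, hlt 4 (by norm_num), hlt 1 (by norm_num)]
        using hlt
    refine (runs_forNbrs hr hi (c := b₃) trivial (J := fun r A =>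
      (∀ d, d ≠ a + 2 → A d = s.arr d) ∧ ∀ j < D.n,
        (j ∈ (D.nbrs i).take r → A (a + 2) j = i + 1) ∧
        (j ∉ (D.nbrs i).take r → A (a + 2) j ≤ i)) h₄.1 ?_ ?_).seq fun s₅ h₅ =>
      (runs_forNbrs hr hi (c := b₄) ⟨trivial, trivial, ⟨trivial, trivial⟩, trivial, trivial⟩
      (J := fun r A => (∀ d, d ≠ a → A d = s₅.arr d) ∧ ∀ j < D.n,
        A a j = if j ∈ (D.nbrs i).take r then F j (i + 1) else F j i) h₅.1 ?_ ?_).mono le_rfl ?_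
    · rw [h₄.2]
      exact ⟨fun _ _ => rfl, fun j hj => ⟨by simp, fun _ => h5 j hj⟩⟩
    · rintro r hr' s' g0 g2 g3 ⟨g4, g5⟩
      refine ⟨fun x _ => by simp [b₃, Cmd.run], fun d hd => ?_, fun d hd => ?_, fun j hj => ?_⟩
      · simp only [b₃, Cmd.run]
        rw [State.setArr_arr_ne _ _ _ (by omega)]
      · simp only [b₃, Cmd.run]
        rw [State.setArr_arr_ne _ _ _ hd]
        exact g4 d hd
      · rw [List.mem_take_succ_iff hr']
        by_cases hjr : j = (D.nbrs i)[r]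
        · simp [b₃, Cmd.run, Expr.eval, g3, g2, hjr]
        · simpa [b₃, Cmd.run, Expr.eval, g3, g2, hjr] using g5 j hj
    · refine ⟨fun _ _ => rfl, fun j hj => ?_⟩
      simp only [List.take_zero, List.not_mem_nil, if_false]
      rw [h₅.2.1 a (by omega), h4 j hj]
    · rintro r hr' s' g0 g2 g3 ⟨g4, g5⟩
      have hmem : (D.nbrs i)[r] ∈ D.nbrs i := List.getElem_mem hr'
      have hlt : (D.nbrs i)[r] < D.n := D.lt_of_mem hmem
      set j := (D.nbrs i)[r] with hj
      have e4 : s'.arr a j = F j i := by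
        rw [g5 j hlt, if_neg ((D.nodup i).getElem_notMem_take hr')]
      have e5 : s'.arr (a + 1) j = g D j := by
        rw [g4 _ (by omega), h₅.2.1 _ (by omega), h3 _ (by omega) (by omega), h₁.2 j hlt]
      have e6 : g D j < D.n → (s'.arr (a + 2) (g D j) = i + 1 ↔ D.Adj i (g D j)) := by
        intro hlt'
        rw [g4 _ (by omega)]
        have := h₅.2.2 (g D j) hlt'
        rw [List.take_length] at this
        by_cases hA : D.Adj i (g D j)
        · simp [hA, this.1 hA]
        · have := this.2 hA
          simp only [hA, iff_false]
          omega
      have hrun : ∃ s'' : State, (∀ x, x = 0 ∨ x = 2 ∨ 7 ≤ x → s''.var x = s'.var x) ∧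
          s''.arr = s'.arr ∧ b₄.run s' = s''.setArr a j (F j (i + 1)) := by
        refine ⟨((s'.setVar 4 (F j i)).setVar 5 (g D j)).setVar 6
          (if D.Adj i (g D j) then 1 else 0), ?_, rfl, ?_⟩
        · rintro x hx
          have : x ≠ 4 ∧ x ≠ 5 ∧ x ≠ 6 := by omega
          simp [this]
        · have eF : F j (i + 1) = op D.n i j (F j i) (g D j)
              (if D.Adj i (g D j) then 1 else 0) := by
            simp only [hF, OrdAdj.fold]
            rw [if_pos (show D.Adj i j from hmem)]
          rw [eF]
          have hb₄ : b₄.run s' = (Cmd.ite C (.write a (.var 3) E) (.write a (.var 3) (.var 4))).run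
            ((Cmd.seq (.assign 4 (.read a (.var 3))) (.seq (.assign 5 (.read (a + 1) (.var 3)))
              (.ite (.lt (.var 5) (.var 0)) (.assign 6 (.eq (.read (a + 2) (.var 5))
                (.succ (.var 2)))) (.assign 6 (.const 0))))).run s') := rfl
          rw [hb₄, hlast]
          by_cases hlt' : g D j < D.n
          · simp [Cmd.run, Expr.eval, g0, g2, g3, e4, e5, hlt', e6 hlt']
          · have hA : ¬ D.Adj i (g D j) := fun h => hlt' (D.lt_of_mem h)
            simp [Cmd.run, Expr.eval, g0, g2, g3, e4, e5, hlt', hA]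
      obtain ⟨s'', q1, q2, q3⟩ := hrun
      rw [q3]
      refine ⟨fun x hx => by simpa using q1 x hx, fun d hd => ?_, fun d hd => ?_, fun k hk => ?_⟩
      · rw [State.setArr_arr_ne _ _ _ (by omega), q2]
      · rw [State.setArr_arr_ne _ _ _ hd, q2, g4 d hd]
      · simp only [List.mem_take_succ_iff hr']
        by_cases hkj : k = j
        · simp [hkj, hj]
        · simpa [← hj, hkj, q2] using g5 k hk
    · rintro s₆ ⟨⟨g0, g2, -, -, -⟩, g3, g4⟩
      refine ⟨g0, g2, fun d hd hd' => ?_, fun j hj => ?_, fun j hj => ?_⟩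
      · rw [g3 d hd, h₅.2.1 d hd', h3 d hd hd']
      · rw [g4 j hj, List.take_length]
        split_ifs with h
        · rfl
        · simp only [hF, OrdAdj.fold]
          rw [if_neg (show ¬ D.Adj i j from h)]
      · rw [g3 _ (by omega)]
        have := h₅.2.2 j hj
        by_cases h : j ∈ (D.nbrs i).take (D.nbrs i).length
        · exact (this.1 h).le
        · exact (this.2 h).trans (by omega)
  · rintro s' ⟨g0, g1, g2, -⟩
    refine ⟨⟨by rw [g0, hs.var_zero], fun d hd => ?_⟩, g2⟩
    rw [g1 d (by omega) (by omega), h₁.1.2 d (by omega)]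
  · simp only [Finset.sum_add_distrib, ← Finset.mul_sum, Finset.sum_const, Finset.card_range,
      smul_eq_mul]
    unfold OrdAdj.size
    set M := ∑ i ∈ Finset.range D.n, (D.nbrs i).length
    nlinarith [Nat.zero_le (M * b₁.bound), Nat.zero_le (M * b₂.bound), Nat.zero_le (M * hd.bound),
      Nat.zero_le (D.n * b₃.bound), Nat.zero_le (D.n * b₄.bound), Nat.zero_le M, Nat.zero_le D.n]

/-! ### Deciding properties, and preparing the input -/

/-- The property `φ` can be decided in linear time, with the answer in register `1`. -/
def LinCheck (φ : OrdAdj → Prop) : Prop :=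
  ∃ c K, ∀ D s, Ready D s → Runs c s (K * D.size)
    (fun s' => Frame 5 s s' ∧ (φ D → s'.var 1 = 1) ∧ (¬ φ D → s'.var 1 = 0))

theorem LinComp.exists {f : OrdAdj → ℕ → ℕ} (hf : LinComp f) :
    LinCheck (fun D => ∃ i < D.n, f D i ≠ 0) := by
  obtain ⟨c, K, hc⟩ := hf 5 le_rfl
  -- The flag lives in entry `0` of array `6`, since loop invariants describe arrays only; it is
  -- copied to register `1` at the end.
  let b : Cmd := .ite (.read 5 (.var 2)) (.write 6 (.const 0) (.const 1)) .skip
  have hb : b.LoopFree := ⟨trivial, trivial⟩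
  refine ⟨.seq c (.seq (.write 6 (.const 0) (.const 0)) (.seq (forRange 2 b)
    (.assign 1 (.read 6 (.const 0))))), K + b.bound + 30, fun D s hs => ?_⟩
  refine ((hc D s hs).seq (Q' := fun s' => Frame 5 s s' ∧
      ((∃ i < D.n, f D i ≠ 0) → s'.var 1 = 1) ∧ (¬ (∃ i < D.n, f D i ≠ 0) → s'.var 1 = 0))
    fun s₁ h₁ => (Cmd.LoopFree.runs (Q := fun s' => s'.var 0 = D.n ∧
      (∀ d < 6, s'.arr d = s₁.arr d) ∧ s'.arr 6 0 = 0) (by trivial) ?_).seq fun s₂ h₂ =>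
    (runs_forRange (T := fun _ => b.bound) (by norm_num) (n := D.n)
      (I := fun k A => (∀ d < 6, A d = s₁.arr d) ∧ ((∃ i < k, f D i ≠ 0) → A 6 0 = 1) ∧
        (¬ (∃ i < k, f D i ≠ 0) → A 6 0 = 0)) h₂.1 ?_ ?_).seq fun s₃ h₃ =>
      Cmd.LoopFree.runs (by trivial) ?_).mono ?_ (fun _ h => h)
  · refine ⟨by simp [Cmd.run, h₁.1.1, hs.var_zero], fun d hd => ?_, by simp [Cmd.run, Expr.eval]⟩
    simp only [Cmd.run]
    rw [State.setArr_arr_ne _ _ _ (by omega)]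
  · exact ⟨h₂.2.1, by simp, fun _ => h₂.2.2⟩
  · rintro i hi s' h0 h2 ⟨h3, h4, h5⟩
    have e : s'.arr 5 i = f D i := by rw [h3 5 (by norm_num), h₁.2 i hi]
    have hlt : (∃ j < i + 1, f D j ≠ 0) ↔ (∃ j < i, f D j ≠ 0) ∨ f D i ≠ 0 := by
      simp only [Nat.lt_succ_iff_lt_or_eq, or_and_right, exists_or, exists_eq_left]
    refine hb.runs ?_
    by_cases hz : f D i = 0
    · have : b.run s' = s' := by simp [b, Cmd.run, Expr.eval, h2, e, hz]
      rw [this, hlt]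
      simp only [hz, ne_eq, not_true_eq_false, or_false]
      exact ⟨h0, h2, h3, h4, h5⟩
    · have : b.run s' = s'.setArr 6 0 1 := by simp [b, Cmd.run, Expr.eval, h2, e, hz]
      rw [this, hlt]
      refine ⟨h0, h2, fun d hd => ?_, by simp, by simp [hz]⟩
      rw [State.setArr_arr_ne _ _ _ (by omega), h3 d hd]
  · refine ⟨⟨by simp [Cmd.run, h₃.1, hs.var_zero], fun d hd => ?_⟩, ?_⟩
    · simp only [Cmd.run, State.setVar_arr]
      rw [h₃.2.1 d (by omega), h₁.1.2 d hd]
    · simpa [Cmd.run, Expr.eval] using h₃.2.2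
  · simp only [Finset.sum_const, Finset.card_range, smul_eq_mul, Cmd.bound, Expr.cost]
    have := D.n_le_size
    have := D.one_le_size
    nlinarith

/-- The ordered graph `(G, τ)` on positions. -/
def ordAdj {n : ℕ} {G : SimpleGraph (Fin n)} (L : AdjLists G) (τ : Fin n ≃ Fin n) : OrdAdj where
  n := n
  nbrs i := if h : i < n then (L.list (τ ⟨i, h⟩)).map (fun w => (τ.symm w : ℕ)) else []
  nodup i := by
    split_ifs with h
    · exact (L.nodup _).map fun x y hxy => τ.symm.injective (Fin.ext hxy)
    · exact List.nodup_nil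
  lt_of_mem {i j} hj := by
    split_ifs at hj with h
    · obtain ⟨w, -, rfl⟩ := List.mem_map.mp hj
      exact Fin.is_lt _
    · simp at hj
  symm {i j} hj := by
    split_ifs at hj with h
    · obtain ⟨w, hw, rfl⟩ := List.mem_map.mp hj
      rw [dif_pos (Fin.is_lt _)]
      refine List.mem_map.mpr ⟨τ ⟨i, h⟩, ?_, by simp⟩
      rw [L.mem_iff] at hw ⊢
      simpa using hw.symm
    · simp at hj
  irrefl i hi := by
    split_ifs at hi with h
    · obtain ⟨w, hw, hwi⟩ := List.mem_map.mp hi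
      obtain rfl : w = τ ⟨i, h⟩ := by
        rw [← τ.symm_apply_eq]; exact Fin.ext hwi
      exact G.loopless.irrefl _ ((L.mem_iff _ _).mp hw)
    · simp at hi

theorem ordAdj_adj {n : ℕ} {G : SimpleGraph (Fin n)} (L : AdjLists G) (τ : Fin n ≃ Fin n)
    (i j : Fin n) : (ordAdj L τ).Adj i j ↔ G.Adj (τ i) (τ j) := by
  have : (ordAdj L τ).nbrs i = (L.list (τ i)).map (fun w => (τ.symm w : ℕ)) := by
    simp [ordAdj]
  unfold OrdAdj.Adj
  rw [this, List.mem_map, ← L.mem_iff]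
  constructor
  · rintro ⟨w, hw, hwj⟩
    rwa [← τ.symm_apply_eq.mp (Fin.ext hwj)]
  · exact fun h => ⟨_, h, by simp⟩

theorem AdjLists.length_list {n : ℕ} {G : SimpleGraph (Fin n)} (L : AdjLists G) :
    ∑ v, (L.list v).length = 2 * G.edgeSet.ncard := by
  classical
  have h1 : ∀ v, (L.list v).length = G.degree v := fun v => by
    rw [← List.toFinset_card_of_nodup (L.nodup v), ← SimpleGraph.card_neighborFinset_eq_degree]
    congr 1
    ext w
    simp [L.mem_iff]
  simp_rw [h1]
  rw [SimpleGraph.sum_degrees_eq_twice_card_edges, ← SimpleGraph.coe_edgeFinset,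
    Set.ncard_coe_finset]

theorem ordAdj_size {n : ℕ} {G : SimpleGraph (Fin n)} (L : AdjLists G) (τ : Fin n ≃ Fin n) :
    (ordAdj L τ).size = n + 2 * G.edgeSet.ncard + 1 := by
  rw [← L.length_list, ← Equiv.sum_comp τ]
  have : ∀ i : Fin n, (L.list (τ i)).length = ((ordAdj L τ).nbrs i).length := fun i => by
    simp [ordAdj]
  simp_rw [this]
  rw [Fin.sum_univ_eq_sum_range (fun i => ((ordAdj L τ).nbrs i).length)]
  rfl

/-- The prefix sums of the lengths are the offsets of the lists in their concatenation; this is how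
arrays `1` and `2` of the input fit together. -/
theorem List.getElem?_flatten_sum_add {α : Type} (l : List (List α)) (v r : ℕ) (hv : v < l.length)
    (hr : r < l[v].length) :
    l.flatten[((l.take v).map List.length).sum + r]? = some l[v][r] := by
  induction l generalizing v with
  | nil => simp at hv
  | cons a l ih =>
    cases v with
    | zero =>
      simp only [List.getElem_cons_zero] at hr
      simp [List.getElem?_append_left hr, hr]
    | succ v =>
      simp only [List.getElem_cons_succ] at hr
      simp only [List.flatten_cons, List.take_succ_cons, List.map_cons, List.sum_cons,
        List.getElem_cons_succ]
      rw [List.getElem?_append_right (by omega), ← ih v (by simpa using hv) hr]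
      congr 1
      omega

/-- The input part of the state. -/
def IsInput {n : ℕ} {G : SimpleGraph (Fin n)} (L : AdjLists G) (τ : Fin n ≃ Fin n)
    (s : State) : Prop :=
  s.var 0 = n ∧ ∀ d < 3, s.arr d = (inputState L τ).arr d

theorem inputState_order {n : ℕ} {G : SimpleGraph (Fin n)} (L : AdjLists G) (τ : Fin n ≃ Fin n)
    (i : Fin n) : (inputState L τ).arr 0 i = τ i := by
  simp [inputState]

theorem inputState_start {n : ℕ} {G : SimpleGraph (Fin n)} (L : AdjLists G) (τ : Fin n ≃ Fin n)
    (v : Fin n) :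
    (inputState L τ).arr 1 (v + 1) = (inputState L τ).arr 1 v + (L.list v).length := by
  have h : (v : ℕ) + 1 ≤ n := v.is_lt
  simp only [inputState, one_ne_zero, if_false, if_true, h, v.is_lt.le]
  rw [List.take_succ_eq_append_getElem (by simp)]
  simp

theorem inputState_entry {n : ℕ} {G : SimpleGraph (Fin n)} (L : AdjLists G) (τ : Fin n ≃ Fin n)
    (v : Fin n) (r : ℕ) (hr : r < (L.list v).length) :
    (inputState L τ).arr 2 ((inputState L τ).arr 1 v + r) = (L.list v)[r] := by
  simp only [inputState, one_ne_zero, OfNat.ofNat_ne_zero, OfNat.ofNat_ne_one, if_false, if_true,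
    v.is_lt.le]
  rw [List.getD_eq_getElem?_getD, List.getElem?_map,
    List.getElem?_flatten_sum_add (List.ofFn L.list) v r (by simp) (by simpa using hr)]
  simp

theorem isInput_ready {n : ℕ} {G : SimpleGraph (Fin n)} {L : AdjLists G} {τ τ' : Fin n ≃ Fin n}
    {s : State} (hs : IsInput L τ s) (h3 : ∀ i : Fin n, s.arr 3 (τ' i) = i)
    (h4 : ∀ i : Fin n, s.arr 4 i = τ' i) : Ready (ordAdj L τ') s := by
  refine ⟨hs.1, fun i hi => ?_, fun i hi r hr => ?_⟩
  · rw [hs.2 1 (by norm_num), h4 ⟨i, hi⟩, inputState_start]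
    have hi' : i < n := hi
    simp [ordAdj, hi']
  · have hi' : i < n := hi
    have hr' : r < (L.list (τ' ⟨i, hi'⟩)).length := by simpa [ordAdj, hi'] using hr
    rw [hs.2 1 (by norm_num), hs.2 2 (by norm_num), h4 ⟨i, hi⟩, inputState_entry _ _ _ _ hr']
    have := h3 (τ'.symm (L.list (τ' ⟨i, hi'⟩))[r])
    simp only [Equiv.apply_symm_apply] at this
    rw [this]
    simp [ordAdj, hi']

/-- The property `φ` of ordered graphs can be decided in linear time from the input. -/
def Detects (φ : OrdAdj → Prop) : Prop :=
  ∃ c K, ∀ (n : ℕ) (G : SimpleGraph (Fin n)) (L : AdjLists G) (τ : Fin n ≃ Fin n) (s : State),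
    IsInput L τ s → Runs c s (K * (n + G.edgeSet.ncard + 1))
      (fun s' => IsInput L τ s' ∧ (φ (ordAdj L τ) → s'.var 1 = 1) ∧
        (¬ φ (ordAdj L τ) → s'.var 1 = 0))

theorem Detects.congr {φ ψ : OrdAdj → Prop} (hφ : Detects φ) (h : ∀ D, φ D ↔ ψ D) : Detects ψ := by
  obtain rfl : φ = ψ := funext fun D => propext (h D)
  exact hφ

/-- The first program leaves the input part intact, so the second can start from it. -/
theorem Detects.or {φ ψ : OrdAdj → Prop} (hφ : Detects φ) (hψ : Detects ψ) :
    Detects (fun D => φ D ∨ ψ D) := by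
  obtain ⟨c, K, hc⟩ := hφ
  obtain ⟨d, K', hd⟩ := hψ
  refine ⟨.seq c (.ite (.var 1) .skip d), K + (K' + 3), fun n G L τ s hs => ?_⟩
  obtain ⟨t, s₁, he, ht, h0, h1, h2⟩ := hc n G L τ s hs
  by_cases hφ : φ (ordAdj L τ)
  · refine ⟨_, s₁, he.seq (.iteTrue (by simp [Expr.eval, h1 hφ]) (.skip _)), ?_, h0, ?_, ?_⟩
    · simp only [Expr.cost]
      nlinarith
    · exact fun _ => h1 hφ
    · exact fun h => absurd (Or.inl hφ) h
  · obtain ⟨t', s₂, he', ht', h0', h1', h2'⟩ := hd n G L τ s₁ h0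
    refine ⟨_, s₂, he.seq (.iteFalse (by simp [Expr.eval, h2 hφ]) he'), ?_, h0', ?_, ?_⟩
    · simp only [Expr.cost]
      nlinarith
    · exact fun h => h1' (h.resolve_left hφ)
    · exact fun h => h2' fun h' => h (Or.inr h')

theorem detects_false : Detects (fun _ => False) := by
  refine ⟨.assign 1 (.const 0), 2, fun n G L τ s hs => ?_⟩
  refine ⟨_, _, .assign _ _ _, by simp [Expr.cost], ?_⟩
  simpa [IsInput, Expr.eval] using hs

theorem Detects.exists_list {ι : Type} {φ : ι → OrdAdj → Prop} (l : List ι)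
    (h : ∀ x ∈ l, Detects (φ x)) : Detects (fun D => ∃ x ∈ l, φ x D) := by
  induction l with
  | nil => exact detects_false.congr (by simp)
  | cons a l ih =>
    refine ((h a (by simp)).or (ih fun x hx => h x (by simp [hx]))).congr fun D => ?_
    simp

/-- Tabulation of the order of the vertices, or of its reverse. -/
theorem LinCheck.detects_of_order {φ : OrdAdj → Prop} (hφ : LinCheck φ) (p : Expr)
    (ρ : ∀ {n : ℕ}, Fin n ≃ Fin n)
    (hp : ∀ (s : State) (n : ℕ) (i : Fin n), s.var 0 = n → s.var 2 = i → p.eval s = (ρ i : Fin n)) :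
    ∃ c K, ∀ (n : ℕ) (G : SimpleGraph (Fin n)) (L : AdjLists G) (τ : Fin n ≃ Fin n) (s : State),
    IsInput L τ s → Runs c s (K * (n + G.edgeSet.ncard + 1))
      (fun s' => IsInput L τ s' ∧ (φ (ordAdj L (ρ.symm.trans τ)) → s'.var 1 = 1) ∧
        (¬ φ (ordAdj L (ρ.symm.trans τ)) → s'.var 1 = 0)) := by
  obtain ⟨c, K, hc⟩ := hφ
  let b : Cmd := .seq (.assign 3 p) (.seq (.write 3 (.read 0 (.var 2)) (.var 3))
    (.write 4 (.var 3) (.read 0 (.var 2))))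
  have hb : b.LoopFree := ⟨trivial, trivial, trivial⟩
  refine ⟨.seq (forRange 2 b) c, b.bound + 13 + 2 * K, fun n G L τ s hs => ?_⟩
  refine ((runs_forRange (T := fun _ => b.bound) (by norm_num) (n := n)
    (I := fun k A => (∀ d < 3, A d = (inputState L τ).arr d) ∧
      ∀ i : Fin n, (i : ℕ) < k → A 3 (τ i) = (ρ i : Fin n) ∧ A 4 (ρ i : Fin n) = τ i)
    hs.1 ⟨hs.2, by simp⟩ ?_).seq fun s₁ h₁ => (hc (ordAdj L (ρ.symm.trans τ)) s₁ ?_).mono le_rfl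
    ?_).mono ?_ (fun _ h => h)
  · rintro i hi s h0 h2 ⟨h3, h4⟩
    have e := hp s n ⟨i, hi⟩ h0 h2
    have e0 : s.arr 0 i = τ ⟨i, hi⟩ := by
      rw [h3 0 (by norm_num)]; exact inputState_order L τ ⟨i, hi⟩
    have hrun : b.run s = ((s.setVar 3 (ρ ⟨i, hi⟩ : Fin n)).setArr 3 (τ ⟨i, hi⟩)
        (ρ ⟨i, hi⟩ : Fin n)).setArr 4 (ρ ⟨i, hi⟩ : Fin n) (τ ⟨i, hi⟩) := by
      simp [b, Cmd.run, Expr.eval, h2, e, e0]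
    refine hb.runs ?_
    rw [hrun]
    refine ⟨by simpa using h0, by simpa using h2, fun d hd => ?_, fun j hj => ?_⟩
    · rw [State.setArr_arr_ne _ _ _ (by omega), State.setArr_arr_ne _ _ _ (by omega)]
      exact h3 d hd
    · rcases Nat.lt_succ_iff_lt_or_eq.mp hj with hj | hj
      · have hne : j ≠ ⟨i, hi⟩ := fun h => by simp [h] at hj
        have n1 : ¬ ((τ j : ℕ) = τ ⟨i, hi⟩) := fun h => hne (τ.injective (Fin.ext h))
        have n2 : ¬ (((ρ j : Fin n) : ℕ) = (ρ ⟨i, hi⟩ : Fin n)) :=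
          fun h => hne (ρ.injective (Fin.ext h))
        simpa [n1, n2] using h4 j hj
      · obtain rfl : j = ⟨i, hi⟩ := Fin.ext hj
        simp
  · refine isInput_ready (τ := τ) ⟨h₁.1, h₁.2.1⟩ (fun i => ?_) (fun i => ?_)
    · have := (h₁.2.2 (ρ.symm i) (Fin.is_lt _)).1
      simpa using this
    · have := (h₁.2.2 (ρ.symm i) (Fin.is_lt _)).2
      simpa using this
  · rintro s' ⟨hf, h⟩
    refine ⟨⟨hf.1.trans h₁.1, fun d hd => ?_⟩, h⟩
    rw [hf.2 d (by omega), h₁.2.1 d hd]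
  · rw [ordAdj_size]
    simp only [Finset.sum_const, Finset.card_range, smul_eq_mul]
    nlinarith [Nat.zero_le (b.bound * G.edgeSet.ncard), Nat.zero_le (K * n)]

theorem LinCheck.detects {φ : OrdAdj → Prop} (hφ : LinCheck φ) : Detects φ :=
  hφ.detects_of_order (.var 2) (Equiv.refl _) (by intro s n i _ h; simpa [Expr.eval] using h)

/-- The reverse of an ordered graph. -/
def OrdAdj.Reverse (D D' : OrdAdj) : Prop :=
  D.n = D'.n ∧ ∀ i < D.n, ∀ j < D.n, D.Adj i j ↔ D'.Adj (D.n - 1 - i) (D.n - 1 - j)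

/-- Running a test on the reversed order gives the test for the reversed property, so each triple
type needs treatment only up to reversal. -/
theorem LinCheck.detects_reverse {φ ψ : OrdAdj → Prop} (hφ : LinCheck φ)
    (h : ∀ D D', OrdAdj.Reverse D D' → (φ D ↔ ψ D')) : Detects ψ := by
  obtain ⟨c, K, hc⟩ := hφ.detects_of_order (.sub (.var 0) (.succ (.var 2))) Fin.revPerm
    (by intro s n i h0 h; simp [Expr.eval, h, h0])
  refine ⟨c, K, fun n G L τ s hs => ?_⟩
  have : φ (ordAdj L (Fin.revPerm.symm.trans τ)) ↔ ψ (ordAdj L τ) := by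
    refine h _ _ ⟨rfl, fun i hi j hj => ?_⟩
    have hi' : i < n := hi
    have hj' : j < n := hj
    rw [ordAdj_adj L _ ⟨i, hi'⟩ ⟨j, hj'⟩]
    have := ordAdj_adj L τ (Fin.rev ⟨i, hi'⟩) (Fin.rev ⟨j, hj'⟩)
    simp only [Fin.val_rev] at this
    rw [show (ordAdj L (Fin.revPerm.symm.trans τ)).n = n from rfl,
      show n - 1 - i = n - (i + 1) by omega, show n - 1 - j = n - (j + 1) by omega, this]
    rfl
  rw [← this]
  exact hc n G L τ s hs

theorem Detects.linearTimeDetectable {φ : OrdAdj → Prop} (hφ : Detects φ) {S : Set (Pattern 3)}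
    (h : ∀ (n : ℕ) (G : SimpleGraph (Fin n)) (L : AdjLists G) (τ : Fin n ≃ Fin n),
      φ (ordAdj L τ) ↔ ContainsSome G τ S) : LinearTimeDetectable S := by
  obtain ⟨c, K, hc⟩ := hφ
  refine ⟨c, K, fun n G L τ => ?_⟩
  obtain ⟨t, s, he, ht, -, h1, h2⟩ := hc n G L τ (inputState L τ)
    ⟨by simp [inputState], fun _ _ => rfl⟩
  rw [h] at h1 h2
  exact ⟨t, s, he, ht, h1, h2⟩

/-! ### Ordered triples -/

/-- Positions `i < j < k` whose pairs `ij`, `jk`, `ik` are related as `a`, `b`, `c` say. -/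
def HasTriple (n : ℕ) (R : ℕ → ℕ → Prop) (a b c : Bool) : Prop :=
  ∃ i j k, i < j ∧ j < k ∧ k < n ∧ (R i j ↔ a = true) ∧ (R j k ↔ b = true) ∧ (R i k ↔ c = true)

open Classical in
/-- The number of later neighbours. -/
noncomputable def up (n : ℕ) (R : ℕ → ℕ → Prop) (i : ℕ) : ℕ :=
  ((Finset.Ioo i n).filter fun x => R i x).card

open Classical in
/-- The number of earlier neighbours. -/
noncomputable def down (R : ℕ → ℕ → Prop) (i : ℕ) : ℕ :=
  ((Finset.range i).filter fun x => R i x).card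

theorem exists_first (n : ℕ) (R : ℕ → ℕ → Prop) (i : ℕ) : ∃ p, i < p ∧ (R i p ∨ n ≤ p) :=
  ⟨i + 1 + n, by omega, Or.inr (by omega)⟩

open Classical in
/-- The first later neighbour, or `n` if there is none. -/
noncomputable def first (n : ℕ) (R : ℕ → ℕ → Prop) (i : ℕ) : ℕ := Nat.find (exists_first n R i)

theorem lt_first (n : ℕ) (R : ℕ → ℕ → Prop) (i : ℕ) : i < first n R i := by
  classical exact (Nat.find_spec (exists_first n R i)).1

theorem rel_first {n : ℕ} {R : ℕ → ℕ → Prop} {i : ℕ} (h : first n R i < n) :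
    R i (first n R i) := by
  classical exact (Nat.find_spec (exists_first n R i)).2.resolve_right (by unfold first at h; omega)

theorem first_le_of_rel {n : ℕ} {R : ℕ → ℕ → Prop} {i x : ℕ} (hx : i < x) (h : R i x) :
    first n R i ≤ x := by
  classical exact Nat.find_min' _ ⟨hx, Or.inl h⟩

theorem first_le {n : ℕ} {R : ℕ → ℕ → Prop} {i : ℕ} (h : i < n) : first n R i ≤ n := by
  classical exact Nat.find_min' _ ⟨h, Or.inr le_rfl⟩

theorem eq_first {n : ℕ} {R : ℕ → ℕ → Prop} {i p : ℕ} (h1 : i < p) (h2 : p ≤ n)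
    (h3 : p < n → R i p) (h4 : ∀ x, i < x → x < p → ¬ R i x) : p = first n R i := by
  refine le_antisymm ?_ ?_
  · by_contra hlt
    push Not at hlt
    exact h4 _ (lt_first n R i) hlt (rel_first (by omega))
  · rcases h2.lt_or_eq with h | rfl
    · exact first_le_of_rel h1 (h3 h)
    · exact first_le h1

theorem up_eq_zero_iff {n : ℕ} {R : ℕ → ℕ → Prop} {i : ℕ} :
    up n R i = 0 ↔ ∀ x, i < x → x < n → ¬ R i x := by
  classical
  simp [up, Finset.filter_eq_empty_iff]

theorem up_ne_zero_iff {n : ℕ} {R : ℕ → ℕ → Prop} {i : ℕ} :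
    up n R i ≠ 0 ↔ first n R i < n := by
  rw [Ne, up_eq_zero_iff]
  push Not
  constructor
  · rintro ⟨x, h1, h2, h3⟩
    exact (first_le_of_rel h1 h3).trans_lt h2
  · exact fun h => ⟨_, lt_first n R i, h, rel_first h⟩

theorem down_ne_zero_iff {R : ℕ → ℕ → Prop} {i : ℕ} : down R i ≠ 0 ↔ ∃ x < i, R i x := by
  classical
  simp [down, Finset.filter_eq_empty_iff]

/-- With the third pair free, the middle position only needs an earlier and a later neighbour. -/
theorem hasTriple_true_true_iff {n : ℕ} {R : ℕ → ℕ → Prop} (hR : ∀ i j, R i j → R j i) :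
    HasTriple n R true true false ∨ HasTriple n R true true true ↔
      ∃ j < n, down R j ≠ 0 ∧ up n R j ≠ 0 := by
  constructor
  · rintro (⟨i, j, k, h1, h2, h3, h4, h5, -⟩ | ⟨i, j, k, h1, h2, h3, h4, h5, -⟩) <;>
    exact ⟨j, by omega, down_ne_zero_iff.mpr ⟨i, h1, hR _ _ (h4.mpr rfl)⟩,
      fun h => up_eq_zero_iff.mp h k h2 h3 (h5.mpr rfl)⟩
  · rintro ⟨j, hj, h1, h2⟩
    obtain ⟨i, hi, hij⟩ := down_ne_zero_iff.mp h1
    have hp := up_ne_zero_iff.mp h2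
    by_cases h : R i (first n R j)
    · exact Or.inr ⟨i, j, _, hi, lt_first _ _ _, hp, by simp [hR _ _ hij], by simp [rel_first hp],
        by simp [h]⟩
    · exact Or.inl ⟨i, j, _, hi, lt_first _ _ _, hp, by simp [hR _ _ hij], by simp [rel_first hp],
        by simp [h]⟩

theorem hasTriple_true_any_true_iff {n : ℕ} {R : ℕ → ℕ → Prop} :
    HasTriple n R true false true ∨ HasTriple n R true true true ↔ ∃ i < n, 1 < up n R i := by
  classical
  unfold up
  simp only [Finset.one_lt_card_iff, Finset.mem_filter, Finset.mem_Ioo]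
  constructor
  · rintro (⟨i, j, k, h1, h2, h3, h4, -, h5⟩ | ⟨i, j, k, h1, h2, h3, h4, -, h5⟩) <;>
    exact ⟨i, by omega, j, k, ⟨⟨h1, by omega⟩, h4.mpr rfl⟩, ⟨⟨by omega, h3⟩, h5.mpr rfl⟩, by omega⟩
  · rintro ⟨i, hi, j, k, ⟨⟨h1, h2⟩, h3⟩, ⟨⟨h4, h5⟩, h6⟩, h7⟩
    have key : ∀ j k, i < j → j < k → k < n → R i j → R i k →
        HasTriple n R true false true ∨ HasTriple n R true true true := by
      intro j k a1 a2 a3 a4 a5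
      by_cases h : R j k
      · exact Or.inr ⟨i, j, k, a1, a2, a3, by simp [a4], by simp [h], by simp [a5]⟩
      · exact Or.inl ⟨i, j, k, a1, a2, a3, by simp [a4], by simp [h], by simp [a5]⟩
    rcases Nat.lt_or_gt_of_ne h7 with h | h
    · exact key j k h1 h h5 h3 h6
    · exact key k j h4 h h2 h6 h3

/-- The triple is missing at `i` exactly when the later neighbours of `i` fill the whole interval
from the first of them to the end, which their number reveals. -/
theorem hasTriple_true_any_false_iff {n : ℕ} {R : ℕ → ℕ → Prop} :
    HasTriple n R true false false ∨ HasTriple n R true true false ↔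
      ∃ i < n, up n R i < n - first n R i := by
  classical
  constructor
  · intro h
    have : ∃ i j k, i < j ∧ j < k ∧ k < n ∧ R i j ∧ ¬ R i k := by
      rcases h with ⟨i, j, k, h1, h2, h3, h4, -, h5⟩ | ⟨i, j, k, h1, h2, h3, h4, -, h5⟩ <;>
      exact ⟨i, j, k, h1, h2, h3, by simpa using h4, by simpa using h5⟩
    obtain ⟨i, j, k, h1, h2, h3, h4, h5⟩ := this
    refine ⟨i, by omega, ?_⟩
    have hle := first_le_of_rel (n := n) h1 h4
    have hsub : (Finset.Ioo i n).filter (fun x => R i x) ⊆ (Finset.Ico (first n R i) n).erase k := by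
      intro x hx
      simp only [Finset.mem_filter, Finset.mem_Ioo] at hx
      simp only [Finset.mem_erase, Finset.mem_Ico]
      exact ⟨fun h => h5 (h ▸ hx.2), first_le_of_rel hx.1.1 hx.2, hx.1.2⟩
    have := Finset.card_le_card hsub
    rw [Finset.card_erase_of_mem (by simp; omega), Nat.card_Ico] at this
    unfold up
    omega
  · rintro ⟨i, hi, h⟩
    have hp : first n R i < n := by omega
    have : ∃ k, k ∈ Finset.Ico (first n R i) n ∧ k ∉ (Finset.Ioo i n).filter (fun x => R i x) := by
      by_contra hc
      push Not at hc
      have := Finset.card_le_card hc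
      rw [Nat.card_Ico] at this
      unfold up at h
      omega
    obtain ⟨k, hk, hk'⟩ := this
    have hlt := lt_first n R i
    simp only [Finset.mem_Ico, Finset.mem_filter, Finset.mem_Ioo] at hk hk'
    have hik : ¬ R i k := fun h => hk' ⟨⟨by omega, hk.2⟩, h⟩
    have hne : k ≠ first n R i := fun h => hik (h ▸ rel_first hp)
    by_cases hpk : R (first n R i) k
    · exact Or.inr ⟨i, _, k, hlt, by omega, hk.2, by simp [rel_first hp], by simp [hpk],
        by simp [hik]⟩
    · exact Or.inl ⟨i, _, k, hlt, by omega, hk.2, by simp [rel_first hp], by simp [hpk],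
        by simp [hik]⟩

/-- Let `p` be the first later neighbour of `i` in a triple `i, j, k`. If `p` is related to both `j`
and `k`, then `p, j, k` is again a triple, with a later start. Otherwise `p` is `j` or fails to be
related to one of them, and `p` can serve as the middle position of a triple starting at `i`. Hence
descent on `n - i`. -/
theorem hasTriple_true_false_true_iff {n : ℕ} {R : ℕ → ℕ → Prop} :
    HasTriple n R true false true ↔
      ∃ i < n, ∃ k, first n R i < k ∧ k < n ∧ R i k ∧ ¬ R (first n R i) k := by
  constructor
  · rintro ⟨i, j, k, h1, h2, h3, h4, h5, h6⟩
    simp only [iff_true, Bool.false_eq_true, iff_false] at h4 h5 h6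
    induction hd : n - i using Nat.strong_induction_on generalizing i with
    | _ d ih =>
      have hle := first_le_of_rel (n := n) h1 h4
      have hlt := lt_first n R i
      by_cases hp : first n R i = j
      · exact ⟨i, by omega, k, by omega, h3, h6, hp ▸ h5⟩
      by_cases hj : R (first n R i) j
      · by_cases hk : R (first n R i) k
        · exact ih _ (by omega) _ (by omega) hj hk rfl
        · exact ⟨i, by omega, k, by omega, h3, h6, hk⟩
      · exact ⟨i, by omega, j, by omega, by omega, h4, hj⟩
  · rintro ⟨i, hi, k, h1, h2, h3, h4⟩
    exact ⟨i, _, k, lt_first _ _ _, h1, h2, by simp [rel_first (h1.trans h2)], by simp [h4],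
      by simp [h3]⟩

/-- Without 010, every position before a related pair is related to one of its two ends. This moves
a triangle first onto position `0` and then onto the first neighbour of `0`, so only this one pair
has to be tested. -/
theorem hasTriple_true_true_true_iff {n : ℕ} {R : ℕ → ℕ → Prop}
    (hirr : ∀ i, ¬ R i i) (h : ¬ HasTriple n R false true false) :
    HasTriple n R true true true ↔ ∃ v < n, R 0 v ∧ R (first n R 0) v := by
  have key : ∀ i j k, i < j → j < k → k < n → R j k → R i j ∨ R i k := by
    intro i j k h1 h2 h3 h4
    by_contra hc
    push Not at hc
    exact h ⟨i, j, k, h1, h2, h3, by simp [hc.1], by simp [h4], by simp [hc.2]⟩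
  constructor
  · rintro ⟨i, j, k, h1, h2, h3, h4, h5, h6⟩
    simp only [iff_true] at h4 h5 h6
    have h0 : ∃ j k, 0 < j ∧ j < k ∧ k < n ∧ R 0 j ∧ R 0 k ∧ R j k := by
      rcases Nat.eq_zero_or_pos i with rfl | hi
      · exact ⟨j, k, h1, h2, h3, h4, h6, h5⟩
      · by_cases ri : R 0 i
        · rcases key 0 j k (by omega) h2 h3 h5 with rj | rk
          · exact ⟨i, j, hi, h1, by omega, ri, rj, h4⟩
          · exact ⟨i, k, hi, by omega, by omega, ri, rk, h6⟩
        · exact ⟨j, k, by omega, h2, h3, (key 0 i j hi h1 (by omega) h4).resolve_left ri,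
            (key 0 i k hi (by omega) h3 h6).resolve_left ri, h5⟩
    obtain ⟨j, k, g1, g2, g3, g4, g5, g6⟩ := h0
    have hle := first_le_of_rel (n := n) g1 g4
    rcases hle.lt_or_eq with hlt | heq
    · rcases key _ j k hlt g2 g3 g6 with r | r
      · exact ⟨j, by omega, g4, r⟩
      · exact ⟨k, g3, g5, r⟩
    · exact ⟨k, g3, g5, heq ▸ g6⟩
  · rintro ⟨v, hv, h1, h2⟩
    have hv0 : 0 < v := Nat.pos_of_ne_zero fun h => hirr 0 (h ▸ h1)
    have hle := first_le_of_rel (n := n) hv0 h1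
    have hne : first n R 0 ≠ v := fun h => hirr v (by rwa [h] at h2)
    exact ⟨0, _, v, lt_first n R 0, by omega, hv,
      by simp [rel_first (show first n R 0 < n by omega)], by simp [h2], by simp [h1]⟩

/-- Let `p` be the first later neighbour of `i`. Without 101, all other later neighbours of `i` are
later neighbours of `p`, so `up i ≤ up p + 1`, with equality exactly when no 110 starts with `i, p`.
If equality always holds, a triple 110 starting at `i` with middle `j ≠ p` yields one starting at
`p` with the same middle, and the descent ends in a contradiction. -/
theorem hasTriple_true_true_false_iff {n : ℕ} {R : ℕ → ℕ → Prop}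
    (h : ¬ HasTriple n R true false true) :
    HasTriple n R true true false ↔
      ∃ i < n, up n R i ≠ 0 ∧ up n R i ≠ up n R (first n R i) + 1 := by
  classical
  have key : ∀ i j k, i < j → j < k → k < n → R i j → R i k → R j k := by
    intro i j k h1 h2 h3 h4 h5
    by_contra hc
    exact h ⟨i, j, k, h1, h2, h3, by simp [h4], by simp [hc], by simp [h5]⟩
  have hup : ∀ i, first n R i < n →
      (up n R i = up n R (first n R i) + 1 ↔ ∀ k, first n R i < k → k < n →
        R (first n R i) k → R i k) := by
    intro i hp
    have hlt := lt_first n R i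
    have e : (Finset.Ioo i n).filter (fun x => R i x) =
        insert (first n R i) ((Finset.Ioo (first n R i) n).filter (fun x => R i x)) := by
      ext x
      simp only [Finset.mem_filter, Finset.mem_Ioo, Finset.mem_insert]
      constructor
      · rintro ⟨⟨h1, h2⟩, h3⟩
        have := first_le_of_rel (n := n) h1 h3
        by_cases hx : x = first n R i
        · exact Or.inl hx
        · exact Or.inr ⟨⟨by omega, h2⟩, h3⟩
      · rintro (rfl | ⟨⟨h1, h2⟩, h3⟩)
        · exact ⟨⟨hlt, hp⟩, rel_first hp⟩
        · exact ⟨⟨by omega, h2⟩, h3⟩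
    have hsub : (Finset.Ioo (first n R i) n).filter (fun x => R i x) ⊆
        (Finset.Ioo (first n R i) n).filter (fun x => R (first n R i) x) := by
      intro x
      simp only [Finset.mem_filter, Finset.mem_Ioo]
      exact fun hx => ⟨hx.1, key i _ x hlt hx.1.1 hx.1.2 (rel_first hp) hx.2⟩
    have hc : up n R i = ((Finset.Ioo (first n R i) n).filter (fun x => R i x)).card + 1 := by
      rw [up, e, Finset.card_insert_of_notMem (by simp)]
    rw [hc, add_left_inj]
    constructor
    · intro heq k h1 h2 h3
      have := Finset.eq_of_subset_of_card_le hsub heq.ge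
      have hk : k ∈ (Finset.Ioo (first n R i) n).filter (fun x => R (first n R i) x) := by
        simp [h1, h2, h3]
      rw [← this] at hk
      exact (Finset.mem_filter.mp hk).2
    · intro hall
      refine le_antisymm (Finset.card_le_card hsub) (Finset.card_le_card fun x hx => ?_)
      simp only [Finset.mem_filter, Finset.mem_Ioo] at hx ⊢
      exact ⟨hx.1, hall x hx.1.1 hx.1.2 hx.2⟩
  constructor
  · rintro ⟨i, j, k, h1, h2, h3, h4, h5, h6⟩
    simp only [iff_true, Bool.false_eq_true, iff_false] at h4 h5 h6
    by_contra hno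
    push Not at hno
    induction hd : n - i using Nat.strong_induction_on generalizing i with
    | _ d ih =>
      have hle := first_le_of_rel (n := n) h1 h4
      have hp : first n R i < n := by omega
      have hlt := lt_first n R i
      have hall := (hup i hp).mp (hno i (by omega) (up_ne_zero_iff.mpr hp))
      rcases hle.lt_or_eq with hlt' | heq
      · exact ih _ (by omega) (first n R i) (by omega) (key i _ j hlt hlt' (by omega)
          (rel_first hp) h4) (fun hk => h6 (hall k (by omega) h3 hk)) rfl
      · exact h6 (hall k (by omega) h3 (heq ▸ h5))
  · rintro ⟨i, hi, h1, h2⟩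
    have hp := up_ne_zero_iff.mp h1
    rw [Ne, hup i hp] at h2
    push Not at h2
    obtain ⟨k, g1, g2, g3, g4⟩ := h2
    exact ⟨i, _, k, lt_first _ _ _, g1, g2, by simp [rel_first hp], by simp [g3], by simp [g4]⟩

/-! ### The tournament of an ordered graph and its scores -/

/-- The tournament in which pairs of adjacent positions point to the later one and the other pairs
to the earlier one. -/
def Beats (R : ℕ → ℕ → Prop) (i x : ℕ) : Prop := (x < i ∧ ¬ R i x) ∨ (i < x ∧ R i x)

/-- The number of positions that `i` beats. -/
noncomputable def score (n : ℕ) (R : ℕ → ℕ → Prop) (i : ℕ) : ℕ := i - down R i + up n R i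

open Classical in
theorem score_eq_card {n : ℕ} {R : ℕ → ℕ → Prop} {i : ℕ} (hi : i < n) :
    score n R i = ((Finset.range n).filter fun x => Beats R i x).card := by
  have h1 : ((Finset.range i).filter fun x => ¬ R i x).card = i - down R i := by
    have := Finset.card_filter_add_card_filter_not (s := Finset.range i) (fun x => R i x)
    rw [Finset.card_range] at this
    unfold down
    omega
  have h2 : (Finset.range n).filter (fun x => Beats R i x) =
      ((Finset.range i).filter fun x => ¬ R i x) ∪ ((Finset.Ioo i n).filter fun x => R i x) := by
    ext x
    simp only [Finset.mem_filter, Finset.mem_range, Finset.mem_union, Finset.mem_Ioo]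
    constructor
    · rintro ⟨h, h' | h'⟩
      · exact Or.inl h'
      · exact Or.inr ⟨⟨h'.1, h⟩, h'.2⟩
    · rintro (h | h)
      · exact ⟨by omega, Or.inl h⟩
      · exact ⟨h.1.2, Or.inr ⟨h.1.1, h.2⟩⟩
  rw [h2, Finset.card_union_of_disjoint, h1]
  · rfl
  · rw [Finset.disjoint_left]
    intro x hx hx'
    simp only [Finset.mem_filter, Finset.mem_range, Finset.mem_Ioo] at hx hx'
    omega

theorem Beats.irrefl {R : ℕ → ℕ → Prop} {i : ℕ} : ¬ Beats R i i := by
  simp [Beats]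

theorem Beats.asymm {R : ℕ → ℕ → Prop} (hR : ∀ i j, R i j → R j i) {i j : ℕ} (h : Beats R i j) :
    ¬ Beats R j i := by
  have := hR i j
  have := hR j i
  unfold Beats at *
  rcases h with h | h <;> rintro (h' | h')
  · omega
  · tauto
  · tauto
  · omega

theorem Beats.total {R : ℕ → ℕ → Prop} (hR : ∀ i j, R i j → R j i) {i j : ℕ} (h : i ≠ j) :
    Beats R i j ∨ Beats R j i := by
  have := hR i j
  have := hR j i
  unfold Beats
  rcases Nat.lt_or_gt_of_ne h with h | h <;> tauto

/-- Start the cyclic triangle at its smallest position: the direction between the other two decides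
which of the two types appears. -/
theorem hasTriple_of_cycle {n : ℕ} {R : ℕ → ℕ → Prop} (hR : ∀ i j, R i j → R j i) {u v x : ℕ}
    (hu : u < n) (hv : v < n) (hx : x < n) (h1 : Beats R u v) (h2 : Beats R v x)
    (h3 : Beats R x u) : HasTriple n R true true false ∨ HasTriple n R false false true := by
  have key : ∀ u v x, v < n → x < n → u < v → u < x → Beats R u v → Beats R v x → Beats R x u →
      HasTriple n R true true false ∨ HasTriple n R false false true := by
    intro u v x hv hx huv hux h1 h2 h3
    have := hR x u
    have := hR u x
    have := hR v x
    have := hR x v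
    unfold Beats at h1 h2 h3
    rcases h2 with h2 | h2
    · right
      refine ⟨u, x, v, hux, h2.1, hv, ?_, ?_, ?_⟩ <;> simp <;> grind
    · left
      refine ⟨u, v, x, huv, h2.1, hx, ?_, ?_, ?_⟩ <;> simp <;> grind
  have n1 : u ≠ v := fun h => Beats.irrefl (h ▸ h1)
  have n2 : v ≠ x := fun h => Beats.irrefl (h ▸ h2)
  have n3 : x ≠ u := fun h => Beats.irrefl (h ▸ h3)
  by_cases hmin : u < v ∧ u < x
  · exact key u v x hv hx hmin.1 hmin.2 h1 h2 h3
  · by_cases hmin' : v < x ∧ v < u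
    · exact key v x u hx hu hmin'.1 hmin'.2 h2 h3 h1
    · exact key x u v hu hv (by omega) (by omega) h3 h1 h2

/-- The types 110 and 001 are exactly the cyclic triangles of the tournament, and a tournament is
transitive if and only if its scores are distinct. -/
theorem hasTriple_cyclic_iff {n : ℕ} {R : ℕ → ℕ → Prop} (hR : ∀ i j, R i j → R j i) :
    HasTriple n R true true false ∨ HasTriple n R false false true ↔
      ¬ Set.InjOn (score n R) (Set.Iio n) := by
  classical
  constructor
  · intro h hinj
    have hlt : ∀ i < n, score n R i < n := by
      intro i hi
      rw [score_eq_card hi]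
      calc _ < (Finset.range n).card := by
            refine Finset.card_lt_card (Finset.filter_ssubset.mpr ⟨i, by simpa using hi, ?_⟩)
            exact Beats.irrefl
        _ = n := Finset.card_range n
    have himg : (Finset.range n).image (score n R) = Finset.range n := by
      refine Finset.eq_of_subset_of_card_le (fun x hx => ?_) ?_
      · obtain ⟨i, hi, rfl⟩ := Finset.mem_image.mp hx
        simpa using hlt i (by simpa using hi)
      · rw [Finset.card_image_of_injOn (by simpa using hinj)]
    have hcount : ∀ m < n, ((Finset.range n).filter fun x => score n R x < m).card = m := by
      intro m hm
      have hi : ((Finset.range n).filter fun x => score n R x < m).image (score n R) =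
          Finset.range m := by
        ext y
        simp only [Finset.mem_image, Finset.mem_filter, Finset.mem_range]
        constructor
        · rintro ⟨x, ⟨-, h⟩, rfl⟩
          exact h
        · intro hy
          have : y ∈ (Finset.range n).image (score n R) := by
            rw [himg]; simp; omega
          obtain ⟨x, hx, rfl⟩ := Finset.mem_image.mp this
          exact ⟨x, ⟨by simpa using hx, hy⟩, rfl⟩
      rw [← Finset.card_image_of_injOn (f := score n R), hi, Finset.card_range]
      refine hinj.mono fun x hx => ?_
      simp only [Finset.coe_filter, Finset.mem_range, Set.mem_ofPred_eq] at hx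
      exact hx.1
    -- The scores are `0, …, n - 1`. By induction a position of score below `m` does not beat `u`,
    -- so `u` beats all `m` of these, and by its score nobody else.
    have hbeats : ∀ m, ∀ u < n, score n R u = m → ∀ v < n, (Beats R u v ↔ score n R v < m) := by
      intro m
      induction m using Nat.strong_induction_on with
      | _ m ih =>
        intro u hu hm
        have hsub : ((Finset.range n).filter fun x => score n R x < m) ⊆
            (Finset.range n).filter fun x => Beats R u x := by
          intro x hx
          simp only [Finset.mem_filter, Finset.mem_range] at hx ⊢
          refine ⟨hx.1, ?_⟩
          have hne : u ≠ x := by rintro rfl; omega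
          refine (Beats.total hR hne).resolve_right fun hb => ?_
          have := (ih _ hx.2 x hx.1 rfl u hu).mp hb
          omega
        have heq := Finset.eq_of_subset_of_card_le hsub (by
          rw [hcount m (hm ▸ hlt u hu), ← score_eq_card hu, hm])
        intro v hv
        have := Finset.ext_iff.mp heq v
        simp only [Finset.mem_filter, Finset.mem_range, hv, true_and] at this
        exact this.symm
    have hmono : ∀ u < n, ∀ v < n, Beats R u v → score n R v < score n R u :=
      fun u hu v hv h => (hbeats _ u hu rfl v hv).mp h
    rcases h with ⟨i, j, k, h1, h2, h3, h4, h5, h6⟩ | ⟨i, j, k, h1, h2, h3, h4, h5, h6⟩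
    · simp only [iff_true, Bool.false_eq_true, iff_false] at h4 h5 h6
      have := hmono i (by omega) j (by omega) (Or.inr ⟨h1, h4⟩)
      have := hmono j (by omega) k (by omega) (Or.inr ⟨h2, h5⟩)
      have := hmono k (by omega) i (by omega) (Or.inl ⟨by omega, fun h => h6 (hR _ _ h)⟩)
      omega
    · simp only [iff_true, Bool.false_eq_true, iff_false] at h4 h5 h6
      have := hmono j (by omega) i (by omega) (Or.inl ⟨h1, fun h => h4 (hR _ _ h)⟩)
      have := hmono k (by omega) j (by omega) (Or.inl ⟨h2, fun h => h5 (hR _ _ h)⟩)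
      have := hmono i (by omega) k (by omega) (Or.inr ⟨by omega, h6⟩)
      omega
  · intro h
    by_contra hc
    refine h ?_
    -- Without cyclic triangles everything beaten by `v` is beaten by `u`, and `u` beats `v` in
    -- addition.
    have hmono : ∀ u < n, ∀ v < n, Beats R u v → score n R v < score n R u := by
      intro u hu v hv huv
      rw [score_eq_card hu, score_eq_card hv]
      refine Finset.card_lt_card ?_
      rw [Finset.ssubset_iff_of_subset]
      · exact ⟨v, by simp [hv, huv], by simp [Beats.irrefl]⟩
      · intro x hx
        simp only [Finset.mem_filter, Finset.mem_range] at hx ⊢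
        refine ⟨hx.1, ?_⟩
        have hne : u ≠ x := by
          rintro rfl
          exact Beats.asymm hR huv hx.2
        exact (Beats.total hR hne).resolve_right fun hb =>
          hc (hasTriple_of_cycle hR hu hv hx.1 huv hx.2 hb)
    intro u hu v hv huv
    by_contra hne
    rcases Beats.total hR hne with hb | hb
    · exact absurd huv (hmono u hu v hv hb).ne'
    · exact absurd huv (hmono v hv u hu hb).ne

/-- Among six positions there are three that are pairwise related or pairwise unrelated. -/
theorem hasTriple_of_six_le {n : ℕ} (hn : 6 ≤ n) (R : ℕ → ℕ → Prop) :
    HasTriple n R true true true ∨ HasTriple n R false false false := by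
  have key : ∀ b : Bool, ∀ x y z, 0 < x → x < y → y < z → z < n → (R 0 x ↔ b = true) →
      (R 0 y ↔ b = true) → (R 0 z ↔ b = true) →
      HasTriple n R b b b ∨ HasTriple n R (!b) (!b) (!b) := by
    intro b x y z h0 h1 h2 h3 rx ry rz
    by_cases hxy : R x y ↔ b = true
    · exact Or.inl ⟨0, x, y, h0, h1, by omega, rx, hxy, ry⟩
    by_cases hyz : R y z ↔ b = true
    · exact Or.inl ⟨0, y, z, by omega, h2, by omega, ry, hyz, rz⟩
    by_cases hxz : R x z ↔ b = true
    · exact Or.inl ⟨0, x, z, by omega, by omega, by omega, rx, hxz, rz⟩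
    refine Or.inr ⟨x, y, z, h1, h2, h3, ?_, ?_, ?_⟩ <;> cases b <;> simp_all
  -- Three of the five positions after `0` are related to `0` in the same way.
  have hpigeon : ∀ f : Fin 5 → Bool, ∃ x y z : Fin 5, x < y ∧ y < z ∧ f y = f x ∧ f z = f x := by
    decide
  classical
  obtain ⟨x, y, z, hxy, hyz, ex, ez⟩ := hpigeon fun x => decide (R 0 (x + 1))
  simp only [decide_eq_decide] at ex ez
  have := key (decide (R 0 (x + 1))) (x + 1) (y + 1) (z + 1) (by omega) (by omega) (by omega)
    (by omega) (by simp) (by simpa using ex) (by simpa using ez)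
  generalize decide (R 0 (x + 1)) = b at this
  cases b
  · exact this.symm
  · exact this

/-! ### Tests for triples in a graph and in its complement -/

namespace OrdAdj

theorem adj_comm (D : OrdAdj) {i j : ℕ} : D.Adj i j ↔ D.Adj j i := ⟨D.symm, D.symm⟩

/-- The adjacency relation (`true`) and that of the complement (`false`). -/
def Rel (D : OrdAdj) : Bool → ℕ → ℕ → Prop
  | true => D.Adj
  | false => fun i j => i ≠ j ∧ i < D.n ∧ j < D.n ∧ ¬ D.Adj i j

theorem Rel.symm (D : OrdAdj) (κ : Bool) (i j : ℕ) (h : D.Rel κ i j) : D.Rel κ j i := by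
  cases κ
  · exact ⟨h.1.symm, h.2.2.1, h.2.1, fun h' => h.2.2.2 (D.symm h')⟩
  · exact D.symm h

theorem Rel.irrefl (D : OrdAdj) (κ : Bool) (i : ℕ) : ¬ D.Rel κ i i := by
  cases κ
  · exact fun h => h.1 rfl
  · exact D.irrefl i

theorem rel_false_iff (D : OrdAdj) {i j : ℕ} (hi : i < D.n) (hj : j < D.n) (hij : i ≠ j) :
    D.Rel false i j ↔ ¬ D.Adj i j := by
  simp [Rel, hi, hj, hij]

theorem hasTriple_rel_false (D : OrdAdj) (a b c : Bool) :
    HasTriple D.n (D.Rel false) a b c ↔ HasTriple D.n D.Adj (!a) (!b) (!c) := by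
  unfold HasTriple
  refine exists_congr fun i => exists_congr fun j => exists_congr fun k => ?_
  refine and_congr_right fun h1 => and_congr_right fun h2 => and_congr_right fun h3 => ?_
  rw [D.rel_false_iff (by omega) (by omega) h1.ne, D.rel_false_iff (by omega) (by omega) h2.ne,
    D.rel_false_iff (by omega) (by omega) (h1.trans h2).ne]
  cases a <;> cases b <;> cases c <;> simp

open Classical in
theorem fold_count (D : OrdAdj) (j : ℕ) (P : ℕ → Prop) [DecidablePred P] (k : ℕ) :
    D.fold 0 (fun i x => if P i then x + 1 else x) j k =
      ((Finset.range k).filter fun i => D.Adj j i ∧ P i).card := by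
  induction k with
  | zero => simp [fold]
  | succ k ih =>
    rw [fold, ih, Finset.range_add_one, Finset.filter_insert]
    by_cases h : D.Adj k j
    · by_cases hP : P k
      · simp [h, hP, D.adj_comm.mp h]
      · simp [h, hP]
    · have : ¬ D.Adj j k := fun h' => h (D.symm h')
      simp [h, this]

end OrdAdj

/-- The conjunction of expressions with values `0` and `1`. -/
def Expr.and (e e' : Expr) : Expr := .sub e (.sub (.const 1) e')

theorem linComp_id : LinComp (fun _ i => i) := LinComp.expr (.var 2) (fun _ i => i) fun _ => rfl

theorem linComp_const (c : ℕ) : LinComp (fun _ _ => c) :=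
  LinComp.expr (.const c) (fun _ _ => c) fun _ => rfl

theorem linComp_up (κ : Bool) : LinComp (fun D => up D.n (D.Rel κ)) := by
  classical
  have h : LinComp (fun D => up D.n D.Adj) := by
    refine (LinComp.scatter linComp_id (.const 0) (.lt (.var 3) (.var 2)) (.succ (.var 4))
      (fun _ _ => 0) (fun _ i j x _ _ => if j < i then x + 1 else x) (fun _ => rfl)
      (fun s => by simp only [Expr.eval]; grind)).congr fun D i hi => ?_
    rw [D.fold_count i (fun x => i < x), up]
    congr 1
    ext x
    simp only [Finset.mem_filter, Finset.mem_range, Finset.mem_Ioo]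
    tauto
  cases κ
  · refine (h.map (.sub (.sub (.var 0) (.succ (.var 2))) (.var 3))
      (fun n i x => n - (i + 1) - x) fun _ => rfl).congr fun D i hi => ?_
    have h1 := Finset.card_filter_add_card_filter_not (s := Finset.Ioo i D.n) (fun x => D.Adj i x)
    have h2 : (Finset.Ioo i D.n).filter (fun x => D.Rel false i x) =
        (Finset.Ioo i D.n).filter (fun x => ¬ D.Adj i x) := by
      refine Finset.filter_congr fun x hx => ?_
      rw [Finset.mem_Ioo] at hx
      exact D.rel_false_iff hi hx.2 hx.1.ne
    rw [Nat.card_Ioo] at h1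
    unfold up
    rw [h2]
    omega
  · exact h

theorem down_rel_false (D : OrdAdj) {i : ℕ} (hi : i < D.n) :
    down (D.Rel false) i = i - down D.Adj i := by
  classical
  have h1 := Finset.card_filter_add_card_filter_not (s := Finset.range i) (fun x => D.Adj i x)
  have h2 : (Finset.range i).filter (fun x => D.Rel false i x) =
      (Finset.range i).filter (fun x => ¬ D.Adj i x) := by
    refine Finset.filter_congr fun x hx => ?_
    rw [Finset.mem_range] at hx
    exact D.rel_false_iff hi (by omega) hx.ne'
  rw [Finset.card_range] at h1
  unfold down
  rw [h2]
  omega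

theorem linComp_down (κ : Bool) : LinComp (fun D => down (D.Rel κ)) := by
  classical
  have h : LinComp (fun D => down D.Adj) := by
    refine (LinComp.scatter linComp_id (.const 0) (.lt (.var 2) (.var 3)) (.succ (.var 4))
      (fun _ _ => 0) (fun _ i j x _ _ => if i < j then x + 1 else x) (fun _ => rfl)
      (fun s => by simp only [Expr.eval]; grind)).congr fun D i hi => ?_
    rw [D.fold_count i (fun x => x < i), down]
    congr 1
    ext x
    simp only [Finset.mem_filter, Finset.mem_range]
    constructor
    · tauto
    · exact fun h => ⟨by omega, h.2, h.1⟩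
  cases κ
  · refine (h.map (.sub (.var 2) (.var 3)) (fun n i x => i - x) fun _ => rfl).congr
      fun D i hi => ?_
    rw [down_rel_false D hi]
  · exact h

/-- In the complement, the candidate starts at `j + 1` and moves up by one whenever the next
neighbour of `j` equals it; since neighbours arrive in increasing order, it stops at the first later
non-neighbour. In the graph itself, the first later neighbour replaces the default `n`, and this
happens only once. -/
theorem linComp_first (κ : Bool) : LinComp (fun D => first D.n (D.Rel κ)) := by
  cases κ
  · refine (LinComp.scatter linComp_id (.succ (.var 2)) (.eq (.var 4) (.var 2)) (.succ (.var 4))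
      (fun _ j => j + 1) (fun _ i _ x _ _ => if x = i then x + 1 else x) (fun _ => rfl)
      (fun s => by simp only [Expr.eval]; grind)).congr fun D j hj => ?_
    have key : ∀ k ≤ D.n, ∃ v, D.fold (j + 1) (fun i x => if x = i then x + 1 else x) j k = v ∧
        j < v ∧ v ≤ D.n ∧ (v ≤ k ∨ v = j + 1) ∧ (∀ x, j < x → x < v → D.Adj x j) ∧
        (v < k → ¬ D.Adj v j) := by
      intro k
      induction k with
      | zero =>
        exact fun _ => ⟨j + 1, rfl, by omega, by omega, by omega, by omega, by omega⟩
      | succ k ih =>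
        intro hk
        obtain ⟨v, h0, h1, h2, h3, h4, h5⟩ := ih (by omega)
        rw [OrdAdj.fold, h0]
        by_cases hA : D.Adj k j
        · by_cases hv : v = k
          · subst hv
            refine ⟨v + 1, by simp [hA], by omega, by omega, by omega, fun x g1 g2 => ?_, by omega⟩
            rcases Nat.lt_succ_iff_lt_or_eq.mp g2 with h | rfl
            · exact h4 x g1 h
            · exact hA
          · exact ⟨v, by simp [hA, hv], h1, h2, by omega, h4, fun h => h5 (by omega)⟩
        · refine ⟨v, by simp [hA], h1, h2, by omega, h4, fun h => ?_⟩
          rcases Nat.lt_succ_iff_lt_or_eq.mp h with h | rfl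
          · exact h5 h
          · exact hA
    obtain ⟨v, h0, h1, h2, -, h4, h5⟩ := key D.n le_rfl
    rw [h0]
    refine eq_first h1 h2 (fun h => ?_) fun x g1 g2 g3 => g3.2.2.2 (D.symm (h4 x g1 g2))
    exact (D.rel_false_iff hj h h1.ne).mpr fun h' => h5 h (D.symm h')
  · refine (LinComp.scatter linComp_id (.var 0)
      (.and (.lt (.var 3) (.var 2)) (.eq (.var 4) (.var 0))) (.var 2)
      (fun n _ => n) (fun n i j x _ _ => if j < i ∧ x = n then i else x) (fun _ => rfl)
      (fun s => by simp only [Expr.eval, Expr.and]; grind)).congr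
      fun D j hj => ?_
    have key : ∀ k ≤ D.n, ∃ v, D.fold D.n (fun i x => if j < i ∧ x = D.n then i else x) j k = v ∧
        (v = D.n ∨ (j < v ∧ v < k ∧ D.Adj v j)) ∧
        (∀ x, j < x → x < k → x < v → ¬ D.Adj x j) := by
      intro k
      induction k with
      | zero => exact fun _ => ⟨_, rfl, Or.inl rfl, by omega⟩
      | succ k ih =>
        intro hk
        obtain ⟨v, h0, h1, h2⟩ := ih (by omega)
        rw [OrdAdj.fold, h0]
        by_cases hA : D.Adj k j ∧ j < k ∧ v = D.n
        · refine ⟨k, by simp [hA], Or.inr ⟨hA.2.1, by omega, hA.1⟩, fun x g1 g2 g3 => ?_⟩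
          exact h2 x g1 g3 (by omega)
        · refine ⟨v, ?_, h1.imp_right fun h => ⟨h.1, by omega, h.2.2⟩, fun x g1 g2 g3 g4 => ?_⟩
          · by_cases hA' : D.Adj k j
            · have : ¬ (j < k ∧ v = D.n) := fun h => hA ⟨hA', h⟩
              simp [this]
            · simp [hA']
          · rcases Nat.lt_succ_iff_lt_or_eq.mp g2 with h | rfl
            · exact h2 x g1 h g3 g4
            · exact hA ⟨g4, g1, h1.resolve_right (by omega)⟩
    obtain ⟨v, h0, h1, h2⟩ := key D.n le_rfl
    rw [h0]
    have hle : v ≤ D.n := by omega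
    exact eq_first (by omega) hle (fun h => D.symm (h1.resolve_left (by omega)).2.2)
      fun x g1 g2 g3 => h2 x g1 (by omega) g2 (D.symm g3)

/-- Whether a position is adjacent to a computed one. -/
theorem LinComp.rel {g : OrdAdj → ℕ → ℕ} (hg : LinComp g) (κ : Bool) :
    LinComp (fun D i => open Classical in if D.Rel κ (g D i) i then 1 else 0) := by
  classical
  have h : LinComp (fun D i => if D.Adj (g D i) i then 1 else 0) := by
    refine (LinComp.scatter hg (.const 0) (.eq (.var 2) (.var 5)) (.succ (.var 4))
      (fun _ _ => 0) (fun _ i _ x y _ => if i = y then x + 1 else x) (fun _ => rfl)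
      (fun s => by simp only [Expr.eval]; grind)).congr fun D i hi => ?_
    rw [D.fold_count i (fun x => x = g D i)]
    by_cases hA : D.Adj (g D i) i
    · rw [if_pos hA, Finset.card_eq_one]
      refine ⟨g D i, ?_⟩
      ext x
      simp only [Finset.mem_filter, Finset.mem_range, Finset.mem_singleton]
      refine ⟨fun h => h.2.2, ?_⟩
      rintro rfl
      exact ⟨D.lt_of_mem (D.symm hA), D.symm hA, rfl⟩
    · rw [if_neg hA, Finset.card_eq_zero, Finset.filter_eq_empty_iff]
      rintro x - ⟨h1, rfl⟩
      exact hA (D.symm h1)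
  cases κ
  · refine (h.map₂ hg (.and (.lt (.var 4) (.var 0)) (.and (.eq (.var 3) (.const 0))
      (.eq (.eq (.var 2) (.var 4)) (.const 0))))
      (fun n i x y => if y < n ∧ x = 0 ∧ i ≠ y then 1 else 0) (fun s => by
        simp only [Expr.eval, Expr.and]; grind)).congr fun D i hi => ?_
    congr 1
    simp only [OrdAdj.Rel, eq_iff_iff]
    split_ifs with hA
    · simp [hA]
    · simp only [true_and, ne_eq, hA, not_false_eq_true, and_true]
      exact ⟨fun h => ⟨fun e => h.2 e.symm, h.1, hi⟩, fun h => ⟨h.2.1, fun e => h.1 e.symm⟩⟩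
  · exact h

open Classical in
/-- The number of common neighbours with a computed position that come after the latter. -/
theorem LinComp.common {g : OrdAdj → ℕ → ℕ} (hg : LinComp g) :
    LinComp (fun D i => ((Finset.Ioo (g D i) D.n).filter
      fun x => D.Adj i x ∧ D.Adj (g D i) x).card) := by
  refine (LinComp.scatter hg (.const 0) (.and (.lt (.var 5) (.var 2)) (.var 6)) (.succ (.var 4))
      (fun _ _ => 0) (fun _ i _ x y q => if y < i ∧ q ≠ 0 then x + 1 else x) (fun _ => rfl)
      (fun s => by
        simp only [Expr.eval, Expr.and]
        grind)).congr fun D i hi => ?_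
  rw [D.fold_count i (fun x => g D i < x ∧ (if D.Adj x (g D i) then 1 else 0) ≠ 0)]
  congr 1
  ext x
  have := D.adj_comm (i := x) (j := g D i)
  simp only [Finset.mem_filter, Finset.mem_range, Finset.mem_Ioo, ne_eq, ite_eq_right_iff,
    one_ne_zero, imp_false, not_not]
  tauto

theorem LinCheck.congr {φ ψ : OrdAdj → Prop} (hφ : LinCheck φ) (h : ∀ D, φ D ↔ ψ D) :
    LinCheck ψ := by
  obtain rfl : φ = ψ := funext fun D => propext (h D)
  exact hφ

theorem linCheck_true_true (κ : Bool) : LinCheck (fun D =>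
    HasTriple D.n (D.Rel κ) true true false ∨ HasTriple D.n (D.Rel κ) true true true) := by
  refine (((linComp_down κ).map₂ (linComp_up κ)
    (.and (.lt (.const 0) (.var 3)) (.lt (.const 0) (.var 4)))
    (fun _ _ x y => if x ≠ 0 ∧ y ≠ 0 then 1 else 0) fun s => by
      simp only [Expr.eval, Expr.and]; grind).exists).congr fun D => ?_
  rw [hasTriple_true_true_iff (OrdAdj.Rel.symm D κ)]
  simp

theorem linCheck_true_any_true (κ : Bool) : LinCheck (fun D =>
    HasTriple D.n (D.Rel κ) true false true ∨ HasTriple D.n (D.Rel κ) true true true) := by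
  refine (((linComp_up κ).map (.lt (.const 1) (.var 3))
    (fun _ _ x => if 1 < x then 1 else 0) fun s => rfl).exists).congr fun D => ?_
  rw [hasTriple_true_any_true_iff]
  simp

theorem linCheck_true_any_false (κ : Bool) : LinCheck (fun D =>
    HasTriple D.n (D.Rel κ) true false false ∨ HasTriple D.n (D.Rel κ) true true false) := by
  refine (((linComp_up κ).map₂ (linComp_first κ) (.lt (.var 3) (.sub (.var 0) (.var 4)))
    (fun n _ x y => if x < n - y then 1 else 0) fun s => rfl).exists).congr fun D => ?_
  rw [hasTriple_true_any_false_iff]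
  simp only [ne_eq, ite_eq_right_iff, one_ne_zero, imp_false, not_not]

theorem linCheck_true_false_true (κ : Bool) : LinCheck (fun D =>
    HasTriple D.n (D.Rel κ) true false true) := by
  classical
  cases κ
  -- For non-adjacency, a failure at `p = first` is a later neighbour of `p` that is not adjacent to
  -- `i`. It exists if and only if the common neighbours after `p` are fewer than all neighbours
  -- after `p`.
  · refine (((linComp_first false).common.map₂ ((linComp_up true).comp (linComp_first false))
      (.lt (.var 3) (.var 4)) (fun _ _ x y => if x < y then 1 else 0) fun s => rfl).exists).congr
      fun D => ?_
    rw [hasTriple_true_false_true_iff]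
    refine exists_congr fun i => and_congr_right fun hi => ?_
    simp only [ne_eq, ite_eq_right_iff, one_ne_zero, imp_false, not_not]
    have hlt := lt_first D.n (D.Rel false) i
    set p := first D.n (D.Rel false) i
    by_cases hp : p < D.n
    · rw [if_pos hp, up]
      constructor
      · intro h
        have : ∃ k, k ∈ (Finset.Ioo p D.n).filter (fun x => D.Rel true p x) ∧
            k ∉ (Finset.Ioo p D.n).filter fun x => D.Adj i x ∧ D.Adj p x := by
          by_contra hc
          push Not at hc
          exact absurd (Finset.card_le_card hc) (by omega)
        obtain ⟨k, h1, h2⟩ := this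
        simp only [Finset.mem_filter, Finset.mem_Ioo] at h1 h2
        refine ⟨k, h1.1.1, h1.1.2, ?_, fun h => h.2.2.2 h1.2⟩
        exact (D.rel_false_iff hi h1.1.2 (by omega)).mpr fun h => h2 ⟨h1.1, h, h1.2⟩
      · rintro ⟨k, h1, h2, h3, h4⟩
        rw [D.rel_false_iff hp h2 h1.ne, not_not] at h4
        refine Finset.card_lt_card ?_
        rw [Finset.ssubset_iff_of_subset]
        · refine ⟨k, Finset.mem_filter.mpr ⟨by simp [h1, h2], h4⟩, ?_⟩
          simp only [Finset.mem_filter, not_and]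
          exact fun _ h => absurd h h3.2.2.2
        · intro x hx
          simp only [Finset.mem_filter] at hx ⊢
          exact ⟨hx.1, hx.2.2⟩
    · rw [if_neg hp]
      simp only [not_lt_zero, false_iff]
      rintro ⟨k, h1, h2, -⟩
      omega
  -- The `+ 1` accounts for `p` itself, a later neighbour of `i` that is not among the common
  -- neighbours after `p`.
  · refine (((linComp_first true).common.map₂ (linComp_up true) (.lt (.succ (.var 3)) (.var 4))
      (fun _ _ x y => if x + 1 < y then 1 else 0) fun s => rfl).exists).congr fun D => ?_
    rw [hasTriple_true_false_true_iff]
    refine exists_congr fun i => and_congr_right fun hi => ?_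
    simp only [ne_eq, ite_eq_right_iff, one_ne_zero, imp_false, not_not]
    have hlt := lt_first D.n (D.Rel true) i
    set p := first D.n (D.Rel true) i with hpdef
    have hsub : ((Finset.Ioo p D.n).filter fun x => D.Adj i x ∧ D.Adj p x) ⊆
        ((Finset.Ioo i D.n).filter fun x => D.Rel true i x).erase p := by
      intro x hx
      simp only [Finset.mem_filter, Finset.mem_Ioo, Finset.mem_erase] at hx ⊢
      exact ⟨by omega, ⟨by omega, hx.1.2⟩, hx.2.1⟩
    by_cases hp : p < D.n
    · have hmem : p ∈ (Finset.Ioo i D.n).filter fun x => D.Rel true i x := by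
        simp only [Finset.mem_filter, Finset.mem_Ioo]
        exact ⟨⟨hlt, hp⟩, rel_first hp⟩
      have hcard := Finset.card_erase_add_one hmem
      rw [up, ← hcard, add_lt_add_iff_right]
      constructor
      · intro h
        have : ∃ k, k ∈ ((Finset.Ioo i D.n).filter fun x => D.Rel true i x).erase p ∧
            k ∉ (Finset.Ioo p D.n).filter fun x => D.Adj i x ∧ D.Adj p x := by
          by_contra hc
          push Not at hc
          exact absurd (Finset.card_le_card hc) (by omega)
        obtain ⟨k, h1, h2⟩ := this
        simp only [Finset.mem_filter, Finset.mem_Ioo, Finset.mem_erase] at h1 h2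
        have hle := first_le_of_rel (n := D.n) h1.2.1.1 h1.2.2
        refine ⟨k, by omega, h1.2.1.2, h1.2.2, fun h => h2 ⟨⟨by omega, h1.2.1.2⟩, h1.2.2, h⟩⟩
      · rintro ⟨k, h1, h2, h3, h4⟩
        refine Finset.card_lt_card ?_
        rw [Finset.ssubset_iff_of_subset hsub]
        refine ⟨k, ?_, ?_⟩
        · simp only [Finset.mem_filter, Finset.mem_Ioo, Finset.mem_erase]
          exact ⟨by omega, ⟨by omega, h2⟩, h3⟩
        · simp only [Finset.mem_filter, not_and]
          exact fun _ _ => h4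
    · have : up D.n (D.Rel true) i = 0 := by
        by_contra h
        exact hp (up_ne_zero_iff.mp h)
      rw [this]
      simp only [not_lt_zero, false_iff]
      rintro ⟨k, h1, h2, -⟩
      omega

/-- The test for three pairwise related positions that works in the absence of another triple. -/
theorem linCheck_true_true_true (κ : Bool) : LinCheck (fun D =>
    ∃ v < D.n, D.Rel κ 0 v ∧ D.Rel κ (first D.n (D.Rel κ) 0) v) := by
  classical
  -- Composition with a constant makes the value at position `0` available at every position.
  refine ((((linComp_const 0).rel κ).map₂ (((linComp_first κ).comp (linComp_const 0)).rel κ)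
    (.and (.var 3) (.var 4)) (fun _ _ x y => x - (1 - y)) fun s => rfl).exists).congr fun D => ?_
  refine exists_congr fun v => and_congr_right fun hv => ?_
  have h0 : 0 < D.n := by omega
  simp only [h0, if_true]
  split_ifs <;> simp_all

/-- The test for two related pairs that works in the absence of another triple. -/
theorem linCheck_true_true_false (κ : Bool) : LinCheck (fun D =>
    ∃ i < D.n, up D.n (D.Rel κ) i ≠ 0 ∧
      up D.n (D.Rel κ) i ≠ up D.n (D.Rel κ) (first D.n (D.Rel κ) i) + 1) := by
  refine (((linComp_up κ).map₂ ((linComp_up κ).comp (linComp_first κ))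
    (.and (.lt (.const 0) (.var 3)) (.eq (.eq (.var 3) (.succ (.var 4))) (.const 0)))
    (fun _ _ x y => if x ≠ 0 ∧ x ≠ y + 1 then 1 else 0) fun s => by
      simp only [Expr.eval, Expr.and]; grind).exists).congr fun D => ?_
  refine exists_congr fun i => and_congr_right fun hi => ?_
  simp only [ne_eq, ite_eq_right_iff, one_ne_zero, imp_false, not_not]
  refine and_congr_right fun h => ?_
  rw [if_pos (up_ne_zero_iff.mp h)]

theorem lastWith_eq_iff {f : ℕ → ℕ} {n : ℕ} :
    (∀ i < n, lastWith f n (f i) = i) ↔ Set.InjOn f (Set.Iio n) := by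
  have hspec : ∀ n i, i < n → f (lastWith f n (f i)) = f i ∧ lastWith f n (f i) < n := by
    intro n
    induction n with
    | zero => omega
    | succ n ih =>
      intro i hi
      rw [lastWith]
      split_ifs with h
      · exact ⟨h, by omega⟩
      · have hin : i < n := by
          rcases Nat.lt_succ_iff_lt_or_eq.mp hi with h' | rfl
          · exact h'
          · exact absurd rfl h
        exact ⟨(ih i hin).1, by have := (ih i hin).2; omega⟩
  constructor
  · intro h i hi j hj hij
    rw [← h i hi, hij, h j hj]
  · intro h i hi
    exact h (hspec n i hi).2 hi (hspec n i hi).1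

theorem linCheck_cyclic : LinCheck (fun D =>
    HasTriple D.n D.Adj true true false ∨ HasTriple D.n D.Adj false false true) := by
  classical
  have hs : LinComp (fun D => score D.n D.Adj) :=
    ((linComp_down false).map₂ (linComp_up true)
      -- Expressions have no addition: `x + y` is written as `n - ((n - x) - y)`, which is correct
      -- because the score is at most `n`.
      (.sub (.var 0) (.sub (.sub (.var 0) (.var 3)) (.var 4)))
      (fun n _ x y => n - ((n - x) - y)) fun s => rfl).congr fun D i hi => by
        rw [down_rel_false D hi, ← show score D.n D.Adj i = _ from rfl]
        have : score D.n D.Adj i ≤ D.n := by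
          rw [score_eq_card hi]
          exact (Finset.card_filter_le _ _).trans (by simp)
        unfold score at this ⊢
        simp only [OrdAdj.Rel]
        omega
  refine ((hs.last.map (.eq (.eq (.var 2) (.var 3)) (.const 0))
    (fun _ i x => if x = i then 0 else 1) fun s => by
      simp only [Expr.eval]; grind).exists).congr fun D => ?_
  rw [hasTriple_cyclic_iff (R := D.Adj) (fun i j h => D.symm h), ← lastWith_eq_iff]
  simp

/-- From six positions on the answer is always yes. Below that, the first two positions of a triple
are among `0, …, 4`, and each such pair gets its own program. -/
theorem detects_monochromatic : Detects (fun D =>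
    HasTriple D.n D.Adj true true true ∨ HasTriple D.n D.Adj false false false) := by
  classical
  have h6 : Detects (fun D => 6 ≤ D.n) :=
    ((LinComp.expr (.lt (.const 5) (.var 0)) (fun n _ => if 5 < n then 1 else 0)
      fun _ => rfl).exists.congr fun D => by
        simp only [ne_eq, ite_eq_right_iff, one_ne_zero, imp_false, not_not]
        exact ⟨fun ⟨i, h1, h2⟩ => h2, fun h => ⟨0, by omega, h⟩⟩).detects
  have hce : ∀ c e κ, Detects (fun D => c < e ∧ ∃ v < D.n, e < v ∧ D.Rel κ c e ∧ D.Rel κ c v ∧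
      D.Rel κ e v) := by
    intro c e κ
    by_cases hlt : c < e
    · have h1 := (linComp_const c).rel κ
      have h2 := (linComp_const e).rel κ
      -- The value at position `e`, namely whether `c` and `e` are related, made available at every
      -- position.
      have h3 := h1.comp (linComp_const e)
      refine (((h1.map₂ h2 (.and (.var 3) (.var 4)) (fun _ _ x y => x - (1 - y))
        fun s => rfl).map₂ h3 (.and (.and (.var 3) (.var 4)) (.lt (.const e) (.var 2)))
        (fun _ i x y => x - (1 - y) - (1 - if e < i then 1 else 0)) fun s => rfl).exists.congr
        fun D => ?_).detects
      simp only [hlt, true_and]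
      refine exists_congr fun v => and_congr_right fun hv => ?_
      by_cases hev : e < v
      · have : e < D.n := by omega
        simp only [this, if_true, hev, true_and]
        split_ifs <;> simp_all
      · simp [hev]
        split_ifs <;> simp
    · exact detects_false.congr fun D => by simp [hlt]
  refine (h6.or (Detects.exists_list (List.range 5) fun c _ =>
    Detects.exists_list (List.range 5) fun e _ =>
    (hce c e true).or (hce c e false))).congr fun D => ?_
  have hκ : ∀ κ, (∃ c e, c < e ∧ ∃ v < D.n, e < v ∧ D.Rel κ c e ∧ D.Rel κ c v ∧
      D.Rel κ e v) ↔ HasTriple D.n (D.Rel κ) true true true := by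
    intro κ
    constructor
    · rintro ⟨c, e, h1, v, h2, h3, h4, h5, h6⟩
      exact ⟨c, e, v, h1, h3, h2, by simp [h4], by simp [h6], by simp [h5]⟩
    · rintro ⟨c, e, v, h1, h2, h3, h4, h5, h6⟩
      exact ⟨c, e, h1, v, h3, h2, h4.mpr rfl, h6.mpr rfl, h5.mpr rfl⟩
  have ht := hκ true
  have hf := hκ false
  rw [D.hasTriple_rel_false] at hf
  rw [← show _ ↔ HasTriple D.n D.Adj true true true from ht,
    ← show _ ↔ HasTriple D.n D.Adj false false false from hf]
  constructor
  · rintro (h | ⟨c, -, e, -, h | h⟩)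
    · rw [ht, hf]
      exact hasTriple_of_six_le h _
    · exact Or.inl ⟨c, e, h⟩
    · exact Or.inr ⟨c, e, h⟩
  · rintro (⟨c, e, h⟩ | ⟨c, e, h⟩)
    · by_cases h6 : 6 ≤ D.n
      · exact Or.inl h6
      · obtain ⟨h1, v, h2, h3, -⟩ := id h
        exact Or.inr ⟨c, by simp; omega, e, by simp; omega, Or.inl h⟩
    · by_cases h6 : 6 ≤ D.n
      · exact Or.inl h6
      · obtain ⟨h1, v, h2, h3, -⟩ := id h
        exact Or.inr ⟨c, by simp; omega, e, by simp; omega, Or.inr h⟩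

theorem LinCheck.or {φ ψ : OrdAdj → Prop} (hφ : LinCheck φ) (hψ : LinCheck ψ) :
    LinCheck (fun D => φ D ∨ ψ D) := by
  obtain ⟨c, K, hc⟩ := hφ
  obtain ⟨d, K', hd⟩ := hψ
  refine ⟨.seq c (.ite (.var 1) .skip d), K + (K' + 3), fun D s hs => ?_⟩
  obtain ⟨t, s₁, he, ht, h0, h1, h2⟩ := hc D s hs
  have := D.one_le_size
  by_cases hφ : φ D
  · refine ⟨_, s₁, he.seq (.iteTrue (by simp [Expr.eval, h1 hφ]) (.skip _)), ?_, h0, ?_, ?_⟩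
    · simp only [Expr.cost]
      nlinarith
    · exact fun _ => h1 hφ
    · exact fun h => absurd (Or.inl hφ) h
  · obtain ⟨t', s₂, he', ht', h0', h1', h2'⟩ := hd D s₁ (hs.frame le_rfl h0)
    refine ⟨_, s₂, he.seq (.iteFalse (by simp [Expr.eval, h2 hφ]) he'), ?_,
      h0.trans h0' le_rfl, ?_, ?_⟩
    · simp only [Expr.cost]
      nlinarith
    · exact fun h => h1' (h.resolve_left hφ)
    · exact fun h => h2' fun h' => h (Or.inr h')

/-! ### Triple types and the pairs of them that can be detected -/

/-- The type of an ordered triple: the answers whether the pairs of its first and second, its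
second and third, and its first and third element are edges. -/
abbrev TripleType : Type := Bool × Bool × Bool

/-- The ordered graph has a triple of type `t`. -/
def OrdAdj.Has (D : OrdAdj) (t : TripleType) : Prop := HasTriple D.n D.Adj t.1 t.2.1 t.2.2

theorem OrdAdj.Reverse.has {D D' : OrdAdj} (h : OrdAdj.Reverse D D') {a b c : Bool}
    (hD : D.Has (a, b, c)) : D'.Has (b, a, c) := by
  obtain ⟨i, j, k, h1, h2, h3, h4, h5, h6⟩ := hD
  obtain ⟨hn, hA⟩ := h
  simp only [] at h4 h5 h6
  rw [hA i (by omega) j (by omega), D'.adj_comm] at h4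
  rw [hA j (by omega) k (by omega), D'.adj_comm] at h5
  rw [hA i (by omega) k (by omega), D'.adj_comm] at h6
  exact ⟨D.n - 1 - k, D.n - 1 - j, D.n - 1 - i, by omega, by omega, by omega, h5, h4, h6⟩

theorem OrdAdj.Reverse.symm {D D' : OrdAdj} (h : OrdAdj.Reverse D D') : OrdAdj.Reverse D' D := by
  obtain ⟨hn, hA⟩ := h
  refine ⟨hn.symm, fun i hi j hj => ?_⟩
  rw [hA _ (by omega) _ (by omega), show D.n - 1 - (D'.n - 1 - i) = i by omega,
    show D.n - 1 - (D'.n - 1 - j) = j by omega]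

theorem OrdAdj.Reverse.has_iff {D D' : OrdAdj} (h : OrdAdj.Reverse D D') (a b c : Bool) :
    D.Has (a, b, c) ↔ D'.Has (b, a, c) :=
  ⟨h.has, h.symm.has⟩

/-- A test for a pair of types also works for the reversed types. -/
theorem LinCheck.detects_pair {a b c a' b' c' : Bool}
    (h : LinCheck (fun D => D.Has (a, b, c) ∨ D.Has (a', b', c'))) :
    Detects (fun D => D.Has (a, b, c) ∨ D.Has (a', b', c')) ∧
      Detects (fun D => D.Has (b, a, c) ∨ D.Has (b', a', c')) :=
  ⟨h.detects, h.detects_reverse fun D D' hD => by rw [hD.has_iff, hD.has_iff]⟩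

theorem has_rel_false (D : OrdAdj) (a b c : Bool) :
    HasTriple D.n (D.Rel false) a b c ↔ D.Has (!a, !b, !c) := D.hasTriple_rel_false a b c

theorem has_rel_true (D : OrdAdj) (a b c : Bool) :
    HasTriple D.n (D.Rel true) a b c ↔ D.Has (a, b, c) := Iff.rfl

/-- The four types with different first two bits are 101, its complement 010, and the reversals 011
and 100. -/
theorem detects_of_ne {a b c : Bool} (hab : a ≠ b) : Detects (fun D => D.Has (a, b, c)) := by
  have ht := (linCheck_true_false_true true)
  have hf := (linCheck_true_false_true false)
  simp only [has_rel_false, has_rel_true, Bool.not_true, Bool.not_false] at ht hf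
  cases a <;> cases b <;> cases c <;> simp only [ne_eq, not_true_eq_false] at hab
  · exact hf.detects
  · exact ht.detects_reverse fun D D' hD => hD.has_iff _ _ _
  · exact hf.detects_reverse fun D D' hD => hD.has_iff _ _ _
  · exact ht.detects

/-- In the absence of a triple `101` (or its complement) the triples `110` can be found. -/
theorem linCheck_101_or_110 (κ : Bool) : LinCheck (fun D =>
    HasTriple D.n (D.Rel κ) true false true ∨ HasTriple D.n (D.Rel κ) true true false) :=
  ((linCheck_true_false_true κ).or (linCheck_true_true_false κ)).congr fun _ =>
    or_congr_right' fun h => (hasTriple_true_true_false_iff h).symm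

theorem hasTriple_not (D : OrdAdj) (κ a b c : Bool) :
    HasTriple D.n (D.Rel (!κ)) a b c ↔ HasTriple D.n (D.Rel κ) (!a) (!b) (!c) := by
  cases κ
  · simp [has_rel_false, has_rel_true]
  · simp [has_rel_false, has_rel_true]

/-- In the absence of a triple `010` (or its complement) the triples `111` can be found. -/
theorem linCheck_010_or_111 (κ : Bool) : LinCheck (fun D =>
    HasTriple D.n (D.Rel κ) false true false ∨ HasTriple D.n (D.Rel κ) true true true) :=
  ((linCheck_true_false_true (!κ)).or (linCheck_true_true_true κ)).congr fun D => by
    rw [hasTriple_not]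
    exact or_congr_right' fun h => (hasTriple_true_true_true_iff (OrdAdj.Rel.irrefl D κ) h).symm

/-- The eight tests and their reversals account for the sixteen pairs: two types that differ in a
single bit amount to one pattern with an undecided pair, and the others are sought in the absence of
101 or 010. -/
theorem detects_ne_or_eq {a b c d e : Bool} (hab : a ≠ b) :
    Detects (fun D => D.Has (a, b, c) ∨ D.Has (d, d, e)) := by
  have t1 := linCheck_true_any_true true
  have f1 := linCheck_true_any_true false
  have t2 := linCheck_true_any_false true
  have f2 := linCheck_true_any_false false
  have t3 := linCheck_101_or_110 true
  have f3 := linCheck_101_or_110 false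
  have t4 := linCheck_010_or_111 true
  have f4 := linCheck_010_or_111 false
  simp only [has_rel_false, has_rel_true, Bool.not_true, Bool.not_false] at t1 f1 t2 f2 t3 f3 t4 f4
  cases a <;> cases b <;> simp only [ne_eq, not_true_eq_false] at hab <;>
    cases c <;> cases d <;> cases e <;>
    first
    | exact t1.detects_pair.1 | exact t1.detects_pair.2
    | exact f1.detects_pair.1 | exact f1.detects_pair.2
    | exact t2.detects_pair.1 | exact t2.detects_pair.2
    | exact f2.detects_pair.1 | exact f2.detects_pair.2
    | exact t3.detects_pair.1 | exact t3.detects_pair.2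
    | exact f3.detects_pair.1 | exact f3.detects_pair.2
    | exact t4.detects_pair.1 | exact t4.detects_pair.2
    | exact f4.detects_pair.1 | exact f4.detects_pair.2

/-- The four cases are 001 or 000, and 111 or 110 (a vertex with neighbours on both sides, in the
complement or the graph); 001 or 110 (cyclic triangles); 111 or 000 (monochromatic triples). -/
theorem detects_eq_or_eq (a b : Bool) :
    Detects (fun D => D.Has (a, a, true) ∨ D.Has (b, b, false)) := by
  have t1 := linCheck_true_true true
  have f1 := linCheck_true_true false
  simp only [has_rel_false, has_rel_true, Bool.not_true, Bool.not_false] at t1 f1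
  cases a <;> cases b
  · exact f1.detects
  · exact linCheck_cyclic.detects.congr fun D => or_comm
  · exact detects_monochromatic
  · exact t1.detects.congr fun D => or_comm

theorem Detects.exists_finset {ι : Type} {φ : ι → OrdAdj → Prop} (F : Finset ι)
    (h : ∀ x ∈ F, Detects (φ x)) : Detects (fun D => ∃ x ∈ F, φ x D) :=
  (Detects.exists_list F.toList fun x hx => h x (by simpa using hx)).congr fun D => by simp

/-- The types in `F` can be detected together in linear time, unless the first two entries of each
of them agree and all their third entries agree. -/
theorem detects_types (F : Finset TripleType)
    (hF : (∃ t ∈ F, t.1 ≠ t.2.1) ∨ ∃ t ∈ F, ∃ u ∈ F, t.2.2 = true ∧ u.2.2 = false) :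
    Detects (fun D => ∃ t ∈ F, D.Has t) := by
  by_cases h : ∃ t ∈ F, t.1 ≠ t.2.1
  · obtain ⟨⟨a, b, c⟩, ht, hab⟩ := h
    -- The type `t` lies in `F`, so it may be added to the test for each `u` without changing the
    -- union.
    refine (Detects.exists_finset F (φ := fun u D => D.Has (a, b, c) ∨ D.Has u) ?_).congr ?_
    · rintro ⟨d, d', e⟩ -
      by_cases hd : d = d'
      · subst hd
        exact detects_ne_or_eq hab
      · exact (detects_of_ne hab).or (detects_of_ne hd)
    · exact fun D => ⟨fun ⟨u, hu, h⟩ => h.elim (fun h => ⟨_, ht, h⟩) fun h => ⟨u, hu, h⟩,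
        fun ⟨u, hu, h⟩ => ⟨u, hu, Or.inr h⟩⟩
  · obtain ⟨⟨a, a', c⟩, ht, ⟨b, b', d⟩, hu, hc, hd⟩ := hF.resolve_left h
    push Not at h
    have ha : a = a' := h _ ht
    have hb : b = b' := h _ hu
    simp only [] at hc hd
    subst ha hb hc hd
    -- Each type is paired with a member of `F` of the opposite third bit.
    refine (Detects.exists_finset F (φ := fun x D => D.Has x ∨
      D.Has (if x.2.2 then (b, b, false) else (a, a, true))) ?_).congr ?_
    · rintro ⟨e, e', f⟩ hx
      obtain rfl : e = e' := h _ hx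
      cases f
      · exact (detects_eq_or_eq a e).congr fun D => or_comm
      · exact detects_eq_or_eq e b
    · refine fun D => ⟨fun ⟨x, hx, h⟩ => ?_, fun ⟨u, hu, h⟩ => ⟨u, hu, Or.inl h⟩⟩
      rcases h with h | h
      · exact ⟨x, hx, h⟩
      · split_ifs at h
        · exact ⟨_, hu, h⟩
        · exact ⟨_, ht, h⟩

/-! ### Graph classes and sets of triple types -/

/-- The ordered graph `(G, τ)` has a triple of type `t`. -/
def TripleIn {V : Type} {n : ℕ} (G : SimpleGraph V) (τ : Fin n ≃ V) (t : TripleType) : Prop :=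
  ∃ i j k, i < j ∧ j < k ∧ (G.Adj (τ i) (τ j) ↔ t.1 = true) ∧
    (G.Adj (τ j) (τ k) ↔ t.2.1 = true) ∧ (G.Adj (τ i) (τ k) ↔ t.2.2 = true)

theorem has_ordAdj_iff {n : ℕ} {G : SimpleGraph (Fin n)} (L : AdjLists G) (τ : Fin n ≃ Fin n)
    (t : TripleType) : (ordAdj L τ).Has t ↔ TripleIn G τ t := by
  constructor
  · rintro ⟨i, j, k, h1, h2, h3, h⟩
    have h3' : k < n := h3
    refine ⟨⟨i, by omega⟩, ⟨j, by omega⟩, ⟨k, h3'⟩, h1, h2, ?_⟩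
    simpa only [← ordAdj_adj L] using h
  · rintro ⟨i, j, k, h1, h2, h⟩
    refine ⟨i, j, k, h1, h2, k.is_lt, ?_⟩
    simpa only [← ordAdj_adj L] using h

/-- The graph on three vertices with the edges that `t` says. -/
def TripleType.graph (t : TripleType) : SimpleGraph (Fin 3) :=
  SimpleGraph.fromRel fun i j =>
    (i = 0 ∧ j = 1 ∧ t.1 = true) ∨ (i = 1 ∧ j = 2 ∧ t.2.1 = true) ∨ (i = 0 ∧ j = 2 ∧ t.2.2 = true)

theorem eq_graph_iff (K : SimpleGraph (Fin 3)) (t : TripleType) :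
    K = t.graph ↔ (K.Adj 0 1 ↔ t.1 = true) ∧ (K.Adj 1 2 ↔ t.2.1 = true) ∧
      (K.Adj 0 2 ↔ t.2.2 = true) := by
  constructor
  · rintro rfl
    simp [TripleType.graph]
  · rintro ⟨h1, h2, h3⟩
    ext i j
    have e1 := K.adj_comm 0 1
    have e2 := K.adj_comm 1 2
    have e3 := K.adj_comm 0 2
    fin_cases i <;> fin_cases j <;> simp [TripleType.graph, ← e1, ← e2, ← e3, h1, h2, h3]

theorem exists_eq_graph (K : SimpleGraph (Fin 3)) : ∃ t : TripleType, K = t.graph := by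
  classical
  exact ⟨(decide (K.Adj 0 1), decide (K.Adj 1 2), decide (K.Adj 0 2)),
    (eq_graph_iff _ _).mpr (by simp)⟩

theorem exists_embedding_iff {V : Type} {n : ℕ} (G : SimpleGraph V) (τ : Fin n ≃ V)
    (t : TripleType) :
    (∃ f : Fin 3 ↪o Fin n, (G.comap fun i => τ (f i)) = t.graph) ↔ TripleIn G τ t := by
  simp only [eq_graph_iff, SimpleGraph.comap_adj]
  constructor
  · rintro ⟨f, h⟩
    exact ⟨f 0, f 1, f 2, f.strictMono (by decide), f.strictMono (by decide), h⟩
  · rintro ⟨i, j, k, h1, h2, h⟩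
    have hf : StrictMono ![i, j, k] := by
      intro x y hxy
      fin_cases x <;> fin_cases y <;> simp_all
      exact h1.trans h2
    exact ⟨OrderEmbedding.ofStrictMono _ hf, h⟩

open Classical in
/-- The triple types that realize a pattern of `S`. -/
noncomputable def typesOf (S : Set (Pattern 3)) : Finset TripleType :=
  Finset.univ.filter fun t => ∃ P ∈ S, P.IsRealization t.graph

/-- Three positions induce exactly one graph on three vertices, so undecided pairs can be resolved
in all possible ways beforehand. -/
theorem containsSome_iff {V : Type} {n : ℕ} (G : SimpleGraph V) (τ : Fin n ≃ V)
    (S : Set (Pattern 3)) : ContainsSome G τ S ↔ ∃ t ∈ typesOf S, TripleIn G τ t := by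
  simp only [ContainsSome, Contains, typesOf, Finset.mem_filter, Finset.mem_univ, true_and,
    ← exists_embedding_iff]
  constructor
  · rintro ⟨P, hP, f, hf⟩
    obtain ⟨t, ht⟩ := exists_eq_graph (G.comap fun i => τ (f i))
    exact ⟨t, ⟨P, hP, ht ▸ hf⟩, f, ht⟩
  · rintro ⟨t, ⟨P, hP, h⟩, f, hf⟩
    exact ⟨P, hP, f, hf ▸ h⟩

/-- The pattern without undecided pairs whose mandatory edges are those of `K`. -/
def decidedPattern (K : SimpleGraph (Fin 3)) : Pattern 3 where
  mandatory := K
  forbidden := Kᶜ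
  disjoint := disjoint_compl_right

theorem decidedPattern_isRealization_iff (K H : SimpleGraph (Fin 3)) :
    (decidedPattern K).IsRealization H ↔ H = K := by
  simp only [Pattern.IsRealization, Pattern.undecided, decidedPattern, sup_compl_eq_top, compl_top,
    sup_bot_eq]
  exact ⟨fun h => le_antisymm h.2 h.1, fun h => ⟨h.ge, h.le⟩⟩

theorem exists_typesOf_eq (F : Finset TripleType) : ∃ S : Set (Pattern 3), typesOf S = F := by
  refine ⟨(fun t => decidedPattern t.graph) '' (F : Set TripleType), ?_⟩
  ext t
  simp only [typesOf, Finset.mem_filter, Finset.mem_univ, true_and, Set.exists_mem_image,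
    decidedPattern_isRealization_iff, Finset.mem_coe]
  constructor
  · rintro ⟨u, hu, h⟩
    have h1 := (eq_graph_iff _ t).mp rfl
    rw [h] at h1
    have h2 := (eq_graph_iff _ u).mp rfl
    have : t = u := by
      refine Prod.ext ?_ (Prod.ext ?_ ?_) <;> rw [Bool.eq_iff_iff]
      · rw [← h1.1, h2.1]
      · rw [← h1.2.1, h2.2.1]
      · rw [← h1.2.2, h2.2.2]
    rwa [this]
  · exact fun h => ⟨t, h, rfl⟩

/-- The graphs with a vertex ordering without triples of the types in `F`. -/
def avoiders (F : Finset TripleType) : GraphClass := fun V _ G =>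
  ∃ (n : ℕ) (τ : Fin n ≃ V), ∀ t ∈ F, ¬ TripleIn G τ t

theorem characterizes_iff (S : Set (Pattern 3)) (C : GraphClass) :
    Characterizes S C ↔ C = avoiders (typesOf S) := by
  simp only [Characterizes, containsSome_iff, not_exists, not_and]
  constructor
  · intro h
    funext V _ G
    exact propext (h V G)
  · rintro rfl V _ G
    rfl

theorem linearTimeDetectable_of_detects {S : Set (Pattern 3)}
    (h : Detects (fun D => ∃ t ∈ typesOf S, D.Has t)) : LinearTimeDetectable S :=
  h.linearTimeDetectable fun n G L τ => by simp only [has_ordAdj_iff, containsSome_iff]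

/-- The type of the complement of a triple. -/
def TripleType.compl (t : TripleType) : TripleType := (!t.1, !t.2.1, !t.2.2)

theorem tripleIn_compl {V : Type} {n : ℕ} (G : SimpleGraph V) (τ : Fin n ≃ V) (t : TripleType) :
    TripleIn Gᶜ τ t ↔ TripleIn G τ t.compl := by
  unfold TripleIn
  refine exists_congr fun i => exists_congr fun j => exists_congr fun k => ?_
  refine and_congr_right fun h1 => and_congr_right fun h2 => ?_
  have n1 : τ i ≠ τ j := fun h => h1.ne (τ.injective h)
  have n2 : τ j ≠ τ k := fun h => h2.ne (τ.injective h)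
  have n3 : τ i ≠ τ k := fun h => (h1.trans h2).ne (τ.injective h)
  obtain ⟨a, b, c⟩ := t
  simp only [SimpleGraph.compl_adj, n1, n2, n3, ne_eq, not_false_eq_true, true_and,
    TripleType.compl]
  cases a <;> cases b <;> cases c <;> simp

theorem avoiders_image_compl (F : Finset TripleType) :
    avoiders (F.image TripleType.compl) = (avoiders F).co := by
  funext V _ G
  refine propext (exists_congr fun n => exists_congr fun τ => ?_)
  simp only [Finset.mem_image, forall_exists_index, and_imp, forall_apply_eq_imp_iff₂,
    tripleIn_compl]

theorem avoiders_triangle : avoiders {(true, true, true)} = triangleFreeGraphs := by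
  funext V _ G
  simp only [avoiders, Finset.mem_singleton, forall_eq, triangleFreeGraphs, eq_iff_iff]
  constructor
  · rintro ⟨n, τ, h⟩ s hs
    classical
    refine h ?_
    obtain ⟨hcl, hcard⟩ := (SimpleGraph.isNClique_iff G).mp hs
    have hc : (s.map τ.symm.toEmbedding).card = 3 := by simpa using hcard
    let f := (s.map τ.symm.toEmbedding).orderEmbOfFin hc
    have hf : ∀ x, τ (f x) ∈ s := by
      intro x
      have := Finset.orderEmbOfFin_mem _ hc x
      obtain ⟨v, hv, e⟩ := Finset.mem_map.mp this
      have : τ (f x) = v := by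
        rw [← τ.eq_symm_apply]; exact e.symm
      rwa [this]
    have hadj : ∀ x y, x ≠ y → G.Adj (τ (f x)) (τ (f y)) := fun x y hxy =>
      hcl (hf x) (hf y) fun h => hxy (f.injective (τ.injective h))
    exact ⟨f 0, f 1, f 2, f.strictMono (by decide), f.strictMono (by decide),
      by simp [hadj 0 1 (by decide)], by simp [hadj 1 2 (by decide)],
      by simp [hadj 0 2 (by decide)]⟩
  · intro h
    obtain ⟨n, ⟨e⟩⟩ := Finite.exists_equiv_fin V
    refine ⟨n, e.symm, ?_⟩
    rintro ⟨i, j, k, h1, h2, h3, h4, h5⟩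
    classical
    refine h {e.symm i, e.symm j, e.symm k} (SimpleGraph.is3Clique_triple_iff.mpr ?_)
    exact ⟨h3.mpr rfl, h5.mpr rfl, h4.mpr rfl⟩

/-- Avoiding 110 says that the relation "earlier and adjacent" is transitive. Conversely, a linear
extension of the partial order is an ordering that avoids 110. -/
theorem avoiders_comparability : avoiders {(true, true, false)} = comparabilityGraphs := by
  funext V _ G
  simp only [avoiders, Finset.mem_singleton, forall_eq, comparabilityGraphs, eq_iff_iff]
  constructor
  · rintro ⟨n, τ, h⟩
    let lt : V → V → Prop := fun u v => τ.symm u < τ.symm v ∧ G.Adj u v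
    have htrans : ∀ u v w, lt u v → lt v w → lt u w := by
      rintro u v w ⟨h1, h2⟩ ⟨h3, h4⟩
      refine ⟨h1.trans h3, ?_⟩
      by_contra hc
      exact h ⟨_, _, _, h1, h3, by simp [h2], by simp [h4], by simp [hc]⟩
    let p : PartialOrder V :=
      { le := fun u v => u = v ∨ lt u v
        le_refl := fun u => Or.inl rfl
        le_trans := by
          rintro u v w (rfl | h1) (rfl | h2)
          · exact Or.inl rfl
          · exact Or.inr h2
          · exact Or.inr h1
          · exact Or.inr (htrans _ _ _ h1 h2)
        le_antisymm := by
          rintro u v (rfl | h1) (h2 | h2)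
          · rfl
          · rfl
          · exact h2.symm
          · exact absurd (h1.1.trans h2.1) (lt_irrefl _) }
    have hp : ∀ u v, p.lt u v ↔ lt u v := by
      intro u v
      rw [show p.lt u v ↔ p.le u v ∧ ¬ p.le v u from p.lt_iff_le_not_ge u v]
      constructor
      · rintro ⟨rfl | h1, h2⟩
        · exact absurd (Or.inl rfl) h2
        · exact h1
      · intro h1
        refine ⟨Or.inr h1, ?_⟩
        rintro (rfl | h2)
        · exact lt_irrefl _ h1.1
        · exact lt_irrefl _ (h1.1.trans h2.1)
    refine ⟨p, fun u v => ?_⟩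
    rw [hp, hp]
    constructor
    · intro huv
      rcases lt_trichotomy (τ.symm u) (τ.symm v) with hlt | heq | hgt
      · exact Or.inl ⟨hlt, huv⟩
      · exact absurd (τ.symm.injective heq) huv.ne
      · exact Or.inr ⟨hgt, huv.symm⟩
    · rintro (h1 | h1)
      · exact h1.2
      · exact h1.2.symm
  · rintro ⟨p, hp⟩
    have : Fintype (LinearExtension V) := Fintype.ofFinite V
    let f := monoEquivOfFin (LinearExtension V) rfl
    let τ : Fin (Fintype.card (LinearExtension V)) ≃ V := f.toEquiv
    have hlt : ∀ i j, i < j → G.Adj (τ i) (τ j) → p.lt (τ i) (τ j) := by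
      intro i j hij hA
      refine ((hp _ _).mp hA).resolve_right fun hgt => ?_
      have h0 : p.le (τ j) (τ i) := le_of_lt hgt
      have h1 : f j ≤ f i := (toLinearExtension (α := V)).monotone h0
      exact absurd (f.le_iff_le.mp h1) (not_le.mpr hij)
    refine ⟨_, τ, ?_⟩
    rintro ⟨i, j, k, h1, h2, h3, h4, h5⟩
    have h6 := lt_trans (hlt i j h1 (h3.mpr rfl)) (hlt j k h2 (h4.mpr rfl))
    simpa using h5.mp ((hp _ _).mpr (Or.inl h6))

/-! ### Orderings that avoid 111 and 001, and bipartite permutation graphs -/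

/-- Parity along pointers to smaller numbers. -/
def pointerColor (p : ℕ → ℕ) (b : ℕ → Bool) (x : ℕ) : Bool :=
  if p x < x then xor (b x) (pointerColor p b (p x)) else false
termination_by x

/-- A triangle-free graph with an ordering in which every position under an edge is adjacent to
one of its ends is bipartite. -/
theorem exists_two_coloring {n : ℕ} {R : ℕ → ℕ → Prop}
    (htri : ∀ i j k, i < j → j < k → k < n → R i j → R j k → ¬ R i k)
    (humb : ∀ i j k, i < j → j < k → k < n → R i k → R i j ∨ R j k) :
    ∃ c : ℕ → Bool, ∀ y < n, ∀ x < y, R x y → c x ≠ c y := by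
  classical
  -- The pointer of `x` is its smallest earlier neighbour, with colour change, if there is one;
  -- otherwise the largest `u` that has an edge passing over `x`, with the same colour. If neither
  -- exists, the entry is irrelevant.
  have hq : ∀ x, ∃ q : ℕ × Bool,
      ((∃ t < x, R t x) → q.1 < x ∧ R q.1 x ∧ q.2 = true ∧ ∀ t < x, R t x → q.1 ≤ t) ∧
      ((¬ ∃ t < x, R t x) → (∃ u < x, ∃ w < n, x < w ∧ R u w) → q.1 < x ∧
        (∃ w < n, x < w ∧ R q.1 w) ∧ q.2 = false ∧
        ∀ u < x, (∃ w < n, x < w ∧ R u w) → u ≤ q.1) := by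
    intro x
    by_cases h : ∃ t < x, R t x
    · exact ⟨(Nat.find h, true), fun _ => ⟨(Nat.find_spec h).1, (Nat.find_spec h).2, rfl,
        fun t h1 h2 => Nat.find_min' h ⟨h1, h2⟩⟩, fun h' => absurd h h'⟩
    · by_cases h' : ∃ u < x, ∃ w < n, x < w ∧ R u w
      · obtain ⟨u, hu, hm⟩ := ((Finset.range x).filter
          fun u => ∃ w < n, x < w ∧ R u w).exists_max_image id (by
            obtain ⟨u, hu, hw⟩ := h'
            exact ⟨u, by simpa using ⟨hu, hw⟩⟩)
        simp only [Finset.mem_filter, Finset.mem_range, id] at hu hm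
        exact ⟨(u, false), fun g => absurd g h, fun _ _ => ⟨hu.1, hu.2, rfl,
          fun v h1 h2 => hm v ⟨h1, h2⟩⟩⟩
      · exact ⟨(0, false), fun g => absurd g h, fun _ g => absurd g h'⟩
  choose q hq1 hq2 using hq
  set c := pointerColor (fun x => (q x).1) (fun x => (q x).2) with hc
  have hc1 : ∀ x, (∃ t < x, R t x) → c x = !c (q x).1 := by
    intro x h
    obtain ⟨h1, -, h3, -⟩ := hq1 x h
    rw [hc, pointerColor, if_pos h1, h3]
    simp
  have hc2 : ∀ x, (¬ ∃ t < x, R t x) → (∃ u < x, ∃ w < n, x < w ∧ R u w) → c x = c (q x).1 := by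
    intro x h h'
    obtain ⟨h1, -, h3, -⟩ := hq2 x h h'
    rw [hc, pointerColor, if_pos h1, h3]
    simp
  refine ⟨c, fun y => ?_⟩
  induction y using Nat.strong_induction_on with
  | _ y ih =>
    intro hy x₀ hx₀ hR₀
    obtain ⟨huy, hRu, -, humin⟩ := hq1 y ⟨x₀, hx₀, hR₀⟩
    have hcy := hc1 y ⟨x₀, hx₀, hR₀⟩
    set u := (q y).1
    -- The colour of `y` is opposite to that of its smallest neighbour `u`, so all earlier
    -- neighbours of `y` must share the colour of `u`.
    suffices hs : ∀ x < y, R x y → c x = c u by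
      rw [hcy, hs x₀ hx₀ hR₀]
      simp
    intro x
    induction x using Nat.strong_induction_on with
    | _ x ihx =>
      intro hxy hRx
      rcases (humin x hxy hRx).lt_or_eq with hux | hux
      swap
      · rw [hux]
      have hnux : ¬ R u x := fun h => htri u x y hux hxy hy h hRx hRu
      by_cases hx : ∃ t < x, R t x
      · obtain ⟨htx, hRt, -, htmin⟩ := hq1 x hx
        have hcx := hc1 x hx
        set t := (q x).1
        -- In both orders of `t` and `u`, the edge passing over the middle one and the absence of
        -- triangles make `t` and `u` adjacent. So they have different colours, and `x` has the
        -- colour of `u`.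
        have hne : t ≠ u := fun h => hnux (h ▸ hRt)
        rcases Nat.lt_or_gt_of_ne hne with htu | hut
        · have hRtu := (humb t u x htu hux (by omega) hRt).resolve_right hnux
          have := ih u huy (by omega) t htu hRtu
          rw [hcx]
          revert this
          cases c t <;> cases c u <;> simp
        · have hRut := (humb u t y hut (by omega) hy hRu).resolve_right
            fun h => htri t x y htx hxy hy hRt hRx h
          have := ih t (by omega) (by omega) u hut hRut
          rw [hcx]
          revert this
          cases c t <;> cases c u <;> simp
      -- Here `x` copies the colour of `v`, and `u ≤ v` because the edge `uy` passes over `x`. If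
      -- `v` is adjacent to `y`, induction applies; otherwise the edges `uv`, `xw` and the position
      -- of `w` relative to `y` lead to a contradiction.
      · have hP : ∃ u < x, ∃ w < n, x < w ∧ R u w := ⟨u, hux, y, hy, hxy, hRu⟩
        obtain ⟨hvx, ⟨w, hwn, hxw, hRvw⟩, -, hvmax⟩ := hq2 x hx hP
        have hcx := hc2 x hx hP
        set v := (q x).1
        rw [hcx]
        rcases (hvmax u hux ⟨y, hy, hxy, hRu⟩).lt_or_eq with huv | huv
        swap
        · rw [huv]
        by_cases hRvy : R v y
        · exact ihx v hvx (by omega) hRvy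
        exfalso
        have hRuv := (humb u v y huv (by omega) hy hRu).resolve_right hRvy
        have hRxw := (humb v x w hvx hxw hwn hRvw).resolve_left fun h => hx ⟨v, hvx, h⟩
        have hwy : w ≠ y := fun h => hRvy (h ▸ hRvw)
        rcases Nat.lt_or_gt_of_ne hwy with hwy | hwy
        · rcases humb u w y (by omega) hwy hy hRu with h | h
          · exact htri u v w huv (by omega) hwn hRuv hRvw h
          · exact htri x w y hxw hwy hy hRxw h hRx
        · rcases humb v y w (by omega) hwy hwn hRvw with h | h
          · exact hRvy h
          · exact htri x y w hxy hwy hwn hRx h hRxw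

/-- Colour the graph with two colours, direct every edge from `false` to `true`, and keep the
direction of the old order on non-edges. This is a total order in which no edge ends where a later
edge begins, so 111 and 110 are absent; non-edges still follow the old order, so 001 stays absent.
-/
theorem avoiders_bipartite_permutation :
    avoiders {(true, true, true), (false, false, true)} =
      avoiders {(true, true, true), (false, false, true), (true, true, false)} := by
  funext V _ G
  simp only [avoiders, Finset.mem_insert, Finset.mem_singleton, forall_eq_or_imp, forall_eq,
    eq_iff_iff]
  refine ⟨?_, fun ⟨n, τ, h⟩ => ⟨n, τ, h.1, h.2.1⟩⟩
  rintro ⟨n, τ, h1, h2⟩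
  let R : ℕ → ℕ → Prop := fun i j => ∃ (hi : i < n) (hj : j < n), G.Adj (τ ⟨i, hi⟩) (τ ⟨j, hj⟩)
  obtain ⟨c, hc⟩ := exists_two_coloring (n := n) (R := R)
    (by
      rintro i j k hij hjk hk ⟨hi, hj, r1⟩ ⟨_, _, r2⟩ ⟨_, _, r3⟩
      exact h1 ⟨⟨i, hi⟩, ⟨j, hj⟩, ⟨k, hk⟩, hij, hjk, by simp [r1], by simp [r2], by simp [r3]⟩)
    (by
      rintro i j k hij hjk hk ⟨hi, _, r⟩
      have hj : j < n := by omega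
      by_contra hn
      push Not at hn
      have n1 : ¬ G.Adj (τ ⟨i, hi⟩) (τ ⟨j, hj⟩) := fun h => hn.1 ⟨hi, hj, h⟩
      have n2 : ¬ G.Adj (τ ⟨j, hj⟩) (τ ⟨k, hk⟩) := fun h => hn.2 ⟨hj, hk, h⟩
      exact h2 ⟨⟨i, hi⟩, ⟨j, hj⟩, ⟨k, hk⟩, hij, hjk, by simp [n1], by simp [n2], by simp [r]⟩)
  let col : V → Bool := fun v => c (τ.symm v)
  have hcol : ∀ u v, G.Adj u v → col u ≠ col v := by
    have key : ∀ u v, τ.symm u < τ.symm v → G.Adj u v → col u ≠ col v := fun u v hlt huv =>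
      hc _ (Fin.is_lt _) _ hlt ⟨Fin.is_lt _, Fin.is_lt _, by simpa using huv⟩
    intro u v huv
    rcases lt_trichotomy (τ.symm u) (τ.symm v) with h | h | h
    · exact key u v h huv
    · exact absurd (τ.symm.injective h) huv.ne
    · exact (key v u h huv.symm).symm
  let T : V → V → Prop := fun u v =>
    (G.Adj u v ∧ col u = false) ∨ (¬ G.Adj u v ∧ τ.symm u < τ.symm v)
  have hnon : ∀ u v w, τ.symm u < τ.symm v → τ.symm v < τ.symm w → ¬ G.Adj u v → ¬ G.Adj v w →
      ¬ G.Adj u w := fun u v w l1 l2 n1 n2 r =>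
    h2 ⟨_, _, _, l1, l2, by simp [n1], by simp [n2], by simp [r]⟩
  have htot : ∀ u v, u ≠ v → T u v ∨ T v u := by
    intro u v huv
    by_cases hA : G.Adj u v
    · have := hcol u v hA
      cases hu : col u
      · exact Or.inl (Or.inl ⟨hA, hu⟩)
      · refine Or.inr (Or.inl ⟨hA.symm, ?_⟩)
        cases hv : col v
        · rfl
        · exact absurd (hu.trans hv.symm) this
    · have hA' : ¬ G.Adj v u := fun h => hA h.symm
      rcases lt_or_gt_of_ne (fun h => huv (τ.symm.injective h) : τ.symm u ≠ τ.symm v) with h | h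
      · exact Or.inl (Or.inr ⟨hA, h⟩)
      · exact Or.inr (Or.inr ⟨hA', h⟩)
  have hasymm : ∀ u v, T u v → ¬ T v u := by
    rintro u v (⟨a1, a2⟩ | ⟨a1, a2⟩) (⟨b1, b2⟩ | ⟨b1, b2⟩)
    · exact hcol u v a1 (a2.trans b2.symm)
    · exact b1 a1.symm
    · exact a1 b1.symm
    · exact lt_irrefl _ (a2.trans b2)
  -- A cyclic triple cannot contain two edges, because they would meet head to tail and disagree on
  -- a colour. With a single edge, the two non-edges follow the old order below that edge and form
  -- 001; without edges, the old order would be cyclic.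
  have htrans : ∀ u v w, T u v → T v w → T u w := by
    intro u v w huv hvw
    by_contra huw
    have hne : u ≠ w := by
      rintro rfl
      exact hasymm _ _ huv hvw
    have hwu := (htot u w hne).resolve_left huw
    rcases huv with ⟨a1, a2⟩ | ⟨a1, a2⟩ <;> rcases hvw with ⟨b1, b2⟩ | ⟨b1, b2⟩ <;>
      rcases hwu with ⟨c1, c2⟩ | ⟨c1, c2⟩
    · exact hcol u v a1 (a2.trans b2.symm)
    · exact hcol u v a1 (a2.trans b2.symm)
    · exact hcol w u c1 (c2.trans a2.symm)
    · exact hnon v w u b2 c2 b1 c1 a1.symm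
    · exact hcol v w b1 (b2.trans c2.symm)
    · exact hnon w u v c2 a2 c1 a1 b1.symm
    · exact hnon u v w a2 b2 a1 b1 c1.symm
    · exact lt_irrefl _ ((a2.trans b2).trans c2)
  classical
  have hT : IsStrictTotalOrder V T :=
    { trichotomous := fun u v g1 g2 => by
        by_contra hne
        exact (htot u v hne).elim g1 g2
      irrefl := fun u h => hasymm u u h h
      trans := htrans }
  let _ : LinearOrder V := linearOrderOfSTO T
  let _ : Fintype V := Fintype.ofFinite V
  let f := monoEquivOfFin V rfl
  have hf : ∀ i j, i < j → T (f i) (f j) := fun i j hij => f.strictMono hij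
  have hedge : ∀ i j, i < j → G.Adj (f i) (f j) → col (f i) = false ∧ col (f j) = true := by
    intro i j hij hA
    rcases hf i j hij with h | h
    · refine ⟨h.2, ?_⟩
      cases hj : col (f j)
      · exact absurd (h.2.trans hj.symm) (hcol _ _ hA)
      · rfl
    · exact absurd hA h.1
  have hpath : ∀ i j k, i < j → j < k → G.Adj (f i) (f j) → ¬ G.Adj (f j) (f k) :=
    fun i j k hij hjk r1 r2 => by
      have := (hedge i j hij r1).2
      rw [(hedge j k hjk r2).1] at this
      exact absurd this (by simp)
  refine ⟨_, f.toEquiv, ?_, ?_, ?_⟩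
  · rintro ⟨i, j, k, hij, hjk, r1, r2, -⟩
    exact hpath i j k hij hjk (r1.mpr rfl) (r2.mpr rfl)
  · rintro ⟨i, j, k, hij, hjk, r1, r2, r3⟩
    have n1 : ¬ G.Adj (f i) (f j) := fun h => by simpa using r1.mp h
    have n2 : ¬ G.Adj (f j) (f k) := fun h => by simpa using r2.mp h
    have l1 := ((hf i j hij).resolve_left fun h => n1 h.1).2
    have l2 := ((hf j k hjk).resolve_left fun h => n2 h.1).2
    exact hnon _ _ _ l1 l2 n1 n2 (r3.mpr rfl)
  · rintro ⟨i, j, k, hij, hjk, r1, r2, -⟩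
    exact hpath i j k hij hjk (r1.mpr rfl) (r2.mpr rfl)

theorem exists_detectable_of_avoiders_eq {C : GraphClass} {F F' : Finset TripleType}
    (hC : C = avoiders F) (hF : avoiders F = avoiders F')
    (h : Detects (fun D => ∃ t ∈ F', D.Has t)) :
    ∃ S' : Set (Pattern 3), Characterizes S' C ∧ LinearTimeDetectable S' := by
  obtain ⟨S', rfl⟩ := exists_typesOf_eq F'
  exact ⟨S', (characterizes_iff S' C).mpr (hC.trans hF), linearTimeDetectable_of_detects h⟩

theorem subset_pair_cases {F : Finset TripleType} {x y : TripleType} (h : F ⊆ {x, y}) :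
    F = ∅ ∨ F = {x} ∨ F = {y} ∨ F = {x, y} := by
  have := Set.subset_pair_iff_eq.mp (Finset.coe_pair (a := x) (b := y) ▸ Finset.coe_subset.mpr h)
  exact_mod_cast this

/-- Outside the scope of `detects_types`, the set `F` lies in {111, 001} or in {000, 110}, according
to the common third bit. Only the two full pairs need a new set of types. -/
theorem mainTheorem8 (C : GraphClass) (S : Set (Pattern 3)) (hS : Characterizes S C)
    (hcomp : C ≠ comparabilityGraphs) (hcocomp : C ≠ comparabilityGraphs.co)
    (htri : C ≠ triangleFreeGraphs) (hcotri : C ≠ triangleFreeGraphs.co) :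
    ∃ S' : Set (Pattern 3), Characterizes S' C ∧ LinearTimeDetectable S' := by
  rw [characterizes_iff] at hS
  generalize typesOf S = F at hS
  by_cases hF : (∃ t ∈ F, t.1 ≠ t.2.1) ∨ ∃ t ∈ F, ∃ u ∈ F, t.2.2 = true ∧ u.2.2 = false
  · exact exists_detectable_of_avoiders_eq hS rfl (detects_types F hF)
  push Not at hF
  obtain ⟨h1, h2⟩ := hF
  have hempty : F = ∅ → ∃ S' : Set (Pattern 3), Characterizes S' C ∧ LinearTimeDetectable S' :=
    fun h => exists_detectable_of_avoiders_eq hS rfl (detects_false.congr fun D => by simp [h])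
  by_cases hc : ∃ t ∈ F, t.2.2 = true
  · obtain ⟨t, ht, htc⟩ := hc
    have hsub : F ⊆ {(true, true, true), (false, false, true)} := by
      rintro ⟨a, b, c⟩ hx
      have e1 := h1 _ hx
      have e2 := h2 t ht _ hx htc
      revert e1 e2
      cases a <;> cases b <;> cases c <;> simp
    rcases subset_pair_cases hsub with rfl | rfl | rfl | rfl
    · exact hempty rfl
    · exact absurd (hS.trans avoiders_triangle) htri
    · refine absurd ?_ hcocomp
      rw [hS, ← avoiders_comparability, ← avoiders_image_compl]
      rfl
    · exact exists_detectable_of_avoiders_eq hS avoiders_bipartite_permutation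
        (detects_types _ (Or.inr ⟨(true, true, true), by simp, (true, true, false), by simp,
          rfl, rfl⟩))
  · push Not at hc
    have hsub : F ⊆ {(false, false, false), (true, true, false)} := by
      rintro ⟨a, b, c⟩ hx
      have e1 := h1 _ hx
      have e2 := hc _ hx
      revert e1 e2
      cases a <;> cases b <;> cases c <;> simp
    rcases subset_pair_cases hsub with rfl | rfl | rfl | rfl
    · exact hempty rfl
    · refine absurd ?_ hcotri
      rw [hS, ← avoiders_triangle, ← avoiders_image_compl]
      rfl
    · exact absurd (hS.trans avoiders_comparability) hcomp
    -- Complementing the equality for {111, 001} adds 001 to {000, 110}.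
    · have := avoiders_image_compl {(true, true, true), (false, false, true)}
      rw [avoiders_bipartite_permutation, ← avoiders_image_compl] at this
      exact exists_detectable_of_avoiders_eq hS this
        (detects_types _ (Or.inr ⟨(false, false, true), by decide, (false, false, false),
          by decide, rfl, rfl⟩))
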